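/- A distance space $(X,\rho)$ is a finite set $X$ with a symmetric function $\rho\colon X\times X\to\mathbb{R}_{\ge 0}$ satisfying $\rho(x,x)=0$ for all $x$ (the triangle inequality is not required). It is $d$-embeddable if there is a (not necessarily injective) map $\varphi\colon X\to\mathbb{R}^d$ with $\rho(x,y)=\|\varphi(x)-\varphi(y)\|_2$ for all $x,y\in X$; the empty space is $d$-embeddable. A $d$-outlier set is a set $A\subseteq X$ such that $(X\setminus A,\rho)$ is $d$-embeddable, and $\mathsf{Opt}_d(X,\rho)$ is the minimum size of a $d$-outlier set. **Theorem.** There are constants $C,c\in\mathbb{N}$ and a single program for the randomized real RAM which, given $n\ge 0$, $d\ge 1$ and the distances of an arbitrary $n$-point distance space $(X,\rho)$, has the following properties. 1. For every outcome of its random choices it halts within $C\cdot 2^d\cdot (n+1)^c$ steps, that is, in time $2^d\cdot n^{\mathcal{O}(1)}$, and the set $A\subseteq X$ that it outputs is a $d$-outlier set. 2. With probability at least $1/2$ it holds that $|A|\le 2\cdot\mathsf{Opt}_d(X,\rho)$. That is, Unweighted Euclidean Embedding with Outliers has a randomized $2$-approximation in time $2^d\cdot n^{\mathcal{O}(1)}$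 with one-sided constant probability of error. Here a randomized real RAM has integer and real registers and arrays of integers and of reals whose cells are addressed by integer registers. Each of the following takes one unit of time: loading a constant, reading or writing an array cell, addition and (truncated) subtraction of nonnegative integers, exact addition, subtraction, multiplication and division of real numbers, comparison of two integers or of two reals, drawing a uniformly random integer from $\{0,\dots,y\}$ for the content $y$ of an integer register, and a step of control flow. -/

import Mathlib

noncomputable section

/-! ### Distance spaces and Euclidean embeddings with outliers -/

/-- A distance space on `X`: a nonnegative symmetric function vanishing on the diagonal. The triangle
inequality is not required, and distinct points may be at distance zero. -/
structure DistanceSpace (X : Type*) where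
  dist : X → X → ℝ
  dist_nonneg : ∀ x y, 0 ≤ dist x y
  dist_symm : ∀ x y, dist x y = dist y x
  dist_self : ∀ x, dist x x = 0

namespace DistanceSpace

/-- The distance subspace on a set `S` of points. -/
def restrict {X : Type*} (R : DistanceSpace X) (S : Set X) : DistanceSpace S where
  dist x y := R.dist x y
  dist_nonneg x y := R.dist_nonneg x y
  dist_symm x y := R.dist_symm x y
  dist_self x := R.dist_self x

/-- Isometric embeddability into Euclidean `d`-space; the embedding need not be injective. -/
def Embeddable {X : Type*} (R : DistanceSpace X) (d : ℕ) : Prop :=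
  ∃ φ : X → EuclideanSpace ℝ (Fin d), ∀ x y, R.dist x y = ‖φ x - φ y‖

/-- `A` is a `d`-outlier set: deleting its points leaves a `d`-embeddable distance space. -/
def IsOutlierSet {X : Type*} (R : DistanceSpace X) (d : ℕ) (A : Finset X) : Prop :=
  (R.restrict {x | x ∉ A}).Embeddable d

/-- The minimum size of a `d`-outlier set. -/
def opt {X : Type*} (R : DistanceSpace X) (d : ℕ) : ℕ :=
  sInf {k | ∃ A : Finset X, R.IsOutlierSet d A ∧ A.card = k}

theorem isOutlierSet_univ {X : Type*} [Fintype X] (R : DistanceSpace X) (d : ℕ) :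
    R.IsOutlierSet d Finset.univ :=
  ⟨fun _ => 0, fun x => absurd (Finset.mem_univ (x : X)) x.2⟩

/-- On a finite distance space the minimum defining `opt` is attained. -/
theorem exists_isOutlierSet_card_eq_opt {X : Type*} [Fintype X] (R : DistanceSpace X) (d : ℕ) :
    ∃ A : Finset X, R.IsOutlierSet d A ∧ A.card = R.opt d :=
  Nat.sInf_mem (s := {k | ∃ A : Finset X, R.IsOutlierSet d A ∧ A.card = k})
    ⟨_, Finset.univ, R.isOutlierSet_univ d, rfl⟩

end DistanceSpace

/-! ### The randomized real RAM -/

namespace RealRAM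

/-- The memory of a real RAM: integer registers, arrays of integers, real registers, and arrays of
reals. A program is a finite text and so names only finitely many registers and arrays; array cells
are addressed by the contents of integer registers. -/
structure Mem where
  word : ℕ → ℕ
  wordArr : ℕ → ℕ → ℕ
  real : ℕ → ℝ
  realArr : ℕ → ℕ → ℝ

/-- The arithmetic operations on reals. There is no rounding and no root extraction. -/
inductive RealOp
  | add
  | sub
  | mul
  | div

/-- Exact real arithmetic (with the convention that a quotient by zero is zero). -/
def RealOp.eval : RealOp → ℝ → ℝ → ℝ
  | add, a, b => a + b
  | sub, a, b => a - b
  | mul, a, b => a * b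
  | div, a, b => a / b

/-- The elementary instructions. Integers can only be added and subtracted (truncating at zero), so
that unit-cost arithmetic cannot create integers with exponentially many digits. -/
inductive Instr
  /-- `x := k`, for integer register `x` and literal `k` -/
  | wordConst (x k : ℕ)
  /-- `x := y + z` -/
  | wordAdd (x y z : ℕ)
  /-- `x := max (y - z) 0` -/
  | wordSub (x y z : ℕ)
  /-- `x := a[y]`, for an array `a` of integers -/
  | wordLoad (x a y : ℕ)
  /-- `a[y] := x`, for an array `a` of integers -/
  | wordStore (a y x : ℕ)
  /-- `x :=` a uniformly random integer in `{0, …, y}`, independent of everything before -/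
  | wordRand (x y : ℕ)
  /-- `u := k`, for real register `u` and an integer literal `k` -/
  | realConst (u : ℕ) (k : ℤ)
  /-- `u := v ∘ w`, for an arithmetic operation `∘` -/
  | realOp (op : RealOp) (u v w : ℕ)
  /-- `u := a[y]`, for an array `a` of reals and integer register `y` -/
  | realLoad (u a y : ℕ)
  /-- `a[y] := u`, for an array `a` of reals and integer register `y` -/
  | realStore (a y u : ℕ)

def Mem.setWord (m : Mem) (x v : ℕ) : Mem :=
  { m with word := Function.update m.word x v }

def Mem.setWordArr (m : Mem) (a i v : ℕ) : Mem :=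
  { m with wordArr := Function.update m.wordArr a (Function.update (m.wordArr a) i v) }

def Mem.setReal (m : Mem) (u : ℕ) (v : ℝ) : Mem :=
  { m with real := Function.update m.real u v }

def Mem.setRealArr (m : Mem) (a i : ℕ) (v : ℝ) : Mem :=
  { m with realArr := Function.update m.realArr a (Function.update (m.realArr a) i v) }

/-- The distribution of the memory after one instruction. -/
def Instr.exec : Instr → Mem → PMF Mem
  | wordConst x k, m => PMF.pure (m.setWord x k)
  | wordAdd x y z, m => PMF.pure (m.setWord x (m.word y + m.word z))
  | wordSub x y z, m => PMF.pure (m.setWord x (m.word y - m.word z))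
  | wordLoad x a y, m => PMF.pure (m.setWord x (m.wordArr a (m.word y)))
  | wordStore a y x, m => PMF.pure (m.setWordArr a (m.word y) (m.word x))
  | wordRand x y, m => (PMF.uniformOfFintype (Fin (m.word y + 1))).map fun r => m.setWord x r
  | realConst u k, m => PMF.pure (m.setReal u k)
  | realOp op u v w, m => PMF.pure (m.setReal u (op.eval (m.real v) (m.real w)))
  | realLoad u a y, m => PMF.pure (m.setReal u (m.realArr a (m.word y)))
  | realStore a y u, m => PMF.pure (m.setRealArr a (m.word y) (m.real u))

/-- The comparisons. -/
inductive Cmp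
  | lt
  | le
  | eq
  | ne

def Cmp.holds {α : Type*} [LinearOrder α] : Cmp → α → α → Prop
  | lt, a, b => a < b
  | le, a, b => a ≤ b
  | eq, a, b => a = b
  | ne, a, b => a ≠ b

/-- A test compares two integer registers or two real registers. -/
inductive Test
  | word (c : Cmp) (x y : ℕ)
  | real (c : Cmp) (u v : ℕ)

def Test.holds : Test → Mem → Prop
  | word c x y, m => c.holds (m.word x) (m.word y)
  | real c u v, m => c.holds (m.real u) (m.real v)

/-- Programs. -/
inductive Program
  | skip
  | instr (i : Instr)
  | seq (p q : Program)
  | ite (t : Test) (p q : Program)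
  | while (t : Test) (p : Program)

/-- A configuration: the stack of program parts still to be executed, and the memory. -/
structure Config where
  todo : List Program
  mem : Mem

/-- The machine has halted when nothing is left to be executed. -/
def Config.Halted (c : Config) : Prop := c.todo = []

open Classical in
/-- One unit-time step: execute one instruction, evaluate one test, or unfold one control
construct. A halted configuration does not change. -/
def step : Config → PMF Config
  | ⟨[], m⟩ => PMF.pure ⟨[], m⟩
  | ⟨.skip :: k, m⟩ => PMF.pure ⟨k, m⟩
  | ⟨.instr i :: k, m⟩ => (i.exec m).map fun m' => ⟨k, m'⟩
  | ⟨.seq p q :: k, m⟩ => PMF.pure ⟨p :: q :: k, m⟩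
  | ⟨.ite t p q :: k, m⟩ => PMF.pure (if t.holds m then ⟨p :: k, m⟩ else ⟨q :: k, m⟩)
  | ⟨.while t p :: k, m⟩ =>
      PMF.pure (if t.holds m then ⟨p :: .while t p :: k, m⟩ else ⟨k, m⟩)

/-- The distribution of the configuration after a given number of steps. -/
def steps : ℕ → Config → PMF Config
  | 0, c => PMF.pure c
  | t + 1, c => (step c).bind (steps t)

/-- The distribution of the configuration after `t` steps of `P` started on memory `m`. -/
def Program.run (P : Program) (m : Mem) (t : ℕ) : PMF Config :=
  steps t ⟨[P], m⟩

/-- The initial memory on input an `n`-point distance space and a dimension `d`: `n` and `d` are in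
the integer registers `0` and `1`, the distance of points `i` and `j` is in cell `i * n + j` of the
real array `0`, and everything else is zero. -/
def inputMem {n : ℕ} (R : DistanceSpace (Fin n)) (d : ℕ) : Mem where
  word x := if x = 0 then n else if x = 1 then d else 0
  wordArr _ _ := 0
  real _ := 0
  realArr a k :=
    if h : a = 0 ∧ k < n * n then
      R.dist (Fin.divNat (⟨k, h.2⟩ : Fin (n * n))) (Fin.modNat (⟨k, h.2⟩ : Fin (n * n)))
    else 0

/-- The output set of points: its indicator vector is read off the integer array `0`. -/
def Config.output (n : ℕ) (c : Config) : Finset (Fin n) :=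
  Finset.univ.filter fun i : Fin n => c.mem.wordArr 0 i ≠ 0

end RealRAM

end

/-! The algorithm keeps a symmetric kernel `g` on the points. It starts, for a random base point `b`, as
`(ρ(x, b)² + ρ(y, b)² - ρ(x, y)²) / 2`, the Gram matrix of any embedding that puts `b` at the origin,
and is changed by pivoting, `g(x, y) - g(x, b) g(y, b) / g(b, b)` for a point `b` with `g(b, b) > 0`,
which projects the points to the orthogonal complement of `b`. No roots are needed.

Soundness (`Remainder.isOutlierSet`): each pivot splits one Euclidean coordinate off the squared distances,
so any set on which `g` vanishes after at most `d` pivots is `d`-embeddable, whatever points were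
chosen. Hence the set of deleted points is an outlier set as soon as `g` vanishes on the rest. Each stage
obtains such a set by deleting all `x` with `g(x, x) ≠ 0` and a greedy matching of the pairs
`g(x, y) ≠ 0` among the others (`IsCandidate`).

Approximation (`stages_success`): let `O` be an optimal outlier set, and suppose that all pivots so far lie
outside `O`. Off `O`, the kernel is a Gram matrix, so points of negative norm belong to `O`, and so does
a point of each matched pair. If at least half of the set `N` of points of positive norm belongs to `O`, the
candidate therefore has at most `2 |O|` points. Otherwise a uniformly random point of `N` lies outside `O`
with probability at least `1 / 2`, and pivoting on it lowers the dimension spanned off `O`; once that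
dimension is zero, `N` is contained in `O`. A repetition thus succeeds with probability at least
`2 ^ (-(d + 1))`, the base point being the first of the random choices, and `2 ^ (d + 1)` repetitions
succeed with probability at least `1 / 2`. The dimension is first lowered to at most the number of
points, so that a repetition takes polynomial time even if `d` is large.

For the machine, the program is written with counting loops only (`Code`). Such programs have a
distribution of results (`Code.run`), a function computing the result if there are no random choices
(`Code.eval`), a syntactic time bound (`Code.cost`) and a syntactic bound on what they change
(`Code.targets`); `Code.runs_compile` relates this to the steps of the machine. Validity of the output for
every outcome is obtained as an event of probability one. -/

noncomputable section

namespace RealRAM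

/-! ### Structured programs with bounded loops -/

/-- Programs whose only loops are counting loops. `loop x y p` runs `p` with the integer register `x`
going through `0, 1, …` below the content of register `y`; register `2` is reserved for the constant
`1` that advances the counters. -/
inductive Code
  | skip
  | instr (i : Instr)
  | seq (p q : Code)
  | ite (t : Test) (p q : Code)
  | loop (x y : ℕ) (p : Code)

instance : Coe Instr Code := ⟨Code.instr⟩

infixr:60 " ;; " => Code.seq

/-- The registers and arrays that an instruction can write to; an array is a single location. -/
inductive Loc
  | word (x : ℕ)
  | wordArr (a : ℕ)
  | real (u : ℕ)
  | realArr (a : ℕ)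
deriving DecidableEq

/-- The location written by an instruction. -/
def Instr.target : Instr → Loc
  | wordConst x _ => .word x
  | wordAdd x _ _ => .word x
  | wordSub x _ _ => .word x
  | wordLoad x _ _ => .word x
  | wordStore a _ _ => .wordArr a
  | wordRand x _ => .word x
  | realConst u _ => .real u
  | realOp _ u _ _ => .real u
  | realLoad u _ _ => .real u
  | realStore a _ _ => .realArr a

/-- The effect of an instruction other than `wordRand`, which is treated as a no-op. -/
def Instr.eval : Instr → Mem → Mem
  | wordConst x k, m => m.setWord x k
  | wordAdd x y z, m => m.setWord x (m.word y + m.word z)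
  | wordSub x y z, m => m.setWord x (m.word y - m.word z)
  | wordLoad x a y, m => m.setWord x (m.wordArr a (m.word y))
  | wordStore a y x, m => m.setWordArr a (m.word y) (m.word x)
  | wordRand _ _, m => m
  | realConst u k, m => m.setReal u k
  | realOp op u v w, m => m.setReal u (op.eval (m.real v) (m.real w))
  | realLoad u a y, m => m.setReal u (m.realArr a (m.word y))
  | realStore a y u, m => m.setRealArr a (m.word y) (m.real u)

/-- An instruction that draws no random number. -/
def Instr.NoRand : Instr → Bool
  | wordRand _ _ => false
  | _ => true

theorem Instr.exec_eq_pure {i : Instr} (h : i.NoRand) (m : Mem) : i.exec m = PMF.pure (i.eval m) := by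
  cases i <;> first | rfl | cases h

/-- The definition of `Instr.exec` coerces the distribution on `Fin` to one on `ℕ` before mapping. -/
theorem Instr.exec_wordRand (x y : ℕ) (m : Mem) : (wordRand x y).exec m =
    (PMF.uniformOfFintype (Fin (m.word y + 1))).map fun r : Fin _ => m.setWord x r :=
  PMF.map_comp (fun r : Fin (m.word y + 1) => (r : ℕ)) _ fun r => m.setWord x r

/-- The memory at the end of one round of a counting loop. -/
def Mem.bump (x : ℕ) (m : Mem) : Mem := (m.setWord 2 1).setWord x (m.word x + 1)

/-- `k`-fold iteration of a random step. -/
def iterRun (f : Mem → PMF Mem) : ℕ → Mem → PMF Mem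
  | 0, m => PMF.pure m
  | k + 1, m => (f m).bind (iterRun f k)

namespace Code

/-- The machine program of a structured program. -/
def compile : Code → Program
  | skip => .skip
  | instr i => .instr i
  | seq p q => .seq p.compile q.compile
  | ite t p q => .ite t p.compile q.compile
  | loop x y p => .seq (.instr (.wordConst x 0)) (.while (.word .lt x y)
      (.seq p.compile (.seq (.instr (.wordConst 2 1)) (.instr (.wordAdd x x 2)))))

open Classical in
/-- The distribution of the memory at the end of a structured program. -/
def run : Code → Mem → PMF Mem
  | skip, m => PMF.pure m
  | instr i, m => i.exec m
  | seq p q, m => (p.run m).bind q.run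
  | ite t p q, m => if t.holds m then p.run m else q.run m
  | loop x y p, m => iterRun (fun m' => (p.run m').map (Mem.bump x)) (m.word y) (m.setWord x 0)

open Classical in
/-- The memory at the end of a structured program that draws no random numbers. -/
def eval : Code → Mem → Mem
  | skip, m => m
  | instr i, m => i.eval m
  | seq p q, m => q.eval (p.eval m)
  | ite t p q, m => if t.holds m then p.eval m else q.eval m
  | loop x y p, m => (fun m' => (p.eval m').bump x)^[m.word y] (m.setWord x 0)

/-- The code draws no random number. -/
def NoRand : Code → Bool
  | skip => true
  | instr i => i.NoRand
  | seq p q => p.NoRand && q.NoRand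
  | ite _ p q => p.NoRand && q.NoRand
  | loop _ _ p => p.NoRand

/-- The locations that the code can write to. -/
def targets : Code → List Loc
  | skip => []
  | instr i => [i.target]
  | seq p q => p.targets ++ q.targets
  | ite _ p q => p.targets ++ q.targets
  | loop x _ p => .word x :: .word 2 :: p.targets

/-- The registers that bound the loops. -/
def limits : Code → List ℕ
  | skip => []
  | instr _ => []
  | seq p q => p.limits ++ q.limits
  | ite _ p q => p.limits ++ q.limits
  | loop _ y p => y :: p.limits

/-- No loop body writes to the counter of its loop. -/
def CountersOK : Code → Bool
  | skip => true
  | instr _ => true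
  | seq p q => p.CountersOK && q.CountersOK
  | ite _ p q => p.CountersOK && q.CountersOK
  | loop x _ p => p.CountersOK && decide (Loc.word x ∉ p.targets) && decide (x ≠ 2)

/-- A bound on the number of steps, given the contents `N` of the registers that bound the loops. -/
def cost (N : ℕ → ℕ) : Code → ℕ
  | skip => 1
  | instr _ => 1
  | seq p q => 1 + p.cost N + q.cost N
  | ite _ p q => 1 + p.cost N + q.cost N
  | loop _ y p => 3 + N y * (p.cost N + 5)

/-- The nesting depth of the loops. -/
def depth : Code → ℕ
  | skip => 0
  | instr _ => 0
  | seq p q => max p.depth q.depth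
  | ite _ p q => max p.depth q.depth
  | loop _ _ p => p.depth + 1

/-- The length of the text, up to constant factors. -/
def size : Code → ℕ
  | skip => 1
  | instr _ => 1
  | seq p q => 1 + p.size + q.size
  | ite _ p q => 1 + p.size + q.size
  | loop _ _ p => 8 + p.size

/-- Loops bounded by `B` that are nested `k` deep take `O(B ^ k)` steps. -/
theorem cost_le {N : ℕ → ℕ} {B : ℕ} (hB : 1 ≤ B) (c : Code) (h : ∀ y ∈ c.limits, N y ≤ B) :
    c.cost N ≤ c.size * B ^ c.depth := by
  induction c with
  | skip => simp [cost, size, depth]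
  | instr i => simp [cost, size, depth]
  | seq p q hp hq | ite t p q hp hq =>
    simp only [limits, List.mem_append] at h
    have h1 := hp fun y hy => h y (.inl hy)
    have h2 := hq fun y hy => h y (.inr hy)
    simp only [cost, size, depth]
    have h3 : B ^ p.depth ≤ B ^ max p.depth q.depth := Nat.pow_le_pow_right hB (le_max_left _ _)
    have h4 : B ^ q.depth ≤ B ^ max p.depth q.depth := Nat.pow_le_pow_right hB (le_max_right _ _)
    have h5 : 1 ≤ B ^ max p.depth q.depth := Nat.one_le_pow _ _ hB
    have h6 := h1.trans (Nat.mul_le_mul_left _ h3)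
    have h7 := h2.trans (Nat.mul_le_mul_left _ h4)
    linarith [add_mul (1 + p.size) q.size (B ^ max p.depth q.depth),
      add_mul 1 p.size (B ^ max p.depth q.depth)]
  | loop x y p hp =>
    simp only [limits, List.mem_cons] at h
    have h1 := hp fun y hy => h y (.inr hy)
    have h2 := h y (.inl rfl)
    simp only [cost, size, depth]
    have h5 : 1 ≤ B ^ p.depth := Nat.one_le_pow _ _ hB
    calc 3 + N y * (p.cost N + 5) ≤ 3 * (B * B ^ p.depth)
          + B * (p.size * B ^ p.depth + 5 * B ^ p.depth) := by
          have : 1 ≤ B * B ^ p.depth := Nat.mul_pos hB h5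
          gcongr <;> omega
      _ = (8 + p.size) * B ^ (p.depth + 1) := by ring

end Code

/-! ### The locations that a structured program leaves alone -/

/-- The memories `m` and `m'` agree except possibly at the locations `L`. -/
structure Agree (L : List Loc) (m m' : Mem) : Prop where
  word : ∀ x, Loc.word x ∉ L → m'.word x = m.word x
  wordArr : ∀ a, Loc.wordArr a ∉ L → m'.wordArr a = m.wordArr a
  real : ∀ u, Loc.real u ∉ L → m'.real u = m.real u
  realArr : ∀ a, Loc.realArr a ∉ L → m'.realArr a = m.realArr a

theorem Agree.refl (L : List Loc) (m : Mem) : Agree L m m :=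
  ⟨fun _ _ => rfl, fun _ _ => rfl, fun _ _ => rfl, fun _ _ => rfl⟩

theorem Agree.trans {L : List Loc} {m m' m'' : Mem} (h : Agree L m m') (h' : Agree L m' m'') :
    Agree L m m'' :=
  ⟨fun x hx => (h'.word x hx).trans (h.word x hx),
    fun x hx => (h'.wordArr x hx).trans (h.wordArr x hx),
    fun x hx => (h'.real x hx).trans (h.real x hx),
    fun x hx => (h'.realArr x hx).trans (h.realArr x hx)⟩

theorem Agree.mono {L L' : List Loc} {m m' : Mem} (h : Agree L m m') (hL : L ⊆ L') :
    Agree L' m m' :=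
  ⟨fun x hx => h.word x fun hh => hx (hL hh), fun x hx => h.wordArr x fun hh => hx (hL hh),
    fun x hx => h.real x fun hh => hx (hL hh), fun x hx => h.realArr x fun hh => hx (hL hh)⟩

section Simp
variable (m : Mem) (x y a b i j u v k : ℕ) (r : ℝ)

@[simp] theorem setWord_word : (m.setWord x v).word y = if y = x then v else m.word y := by
  simp [Mem.setWord, Function.update_apply]
@[simp] theorem setWord_wordArr : (m.setWord x v).wordArr = m.wordArr := rfl
@[simp] theorem setWord_real : (m.setWord x v).real = m.real := rfl
@[simp] theorem setWord_realArr : (m.setWord x v).realArr = m.realArr := rfl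
@[simp] theorem setWordArr_word : (m.setWordArr a i v).word = m.word := rfl
@[simp] theorem setWordArr_wordArr : (m.setWordArr a i v).wordArr b =
    if b = a then Function.update (m.wordArr a) i v else m.wordArr b := by
  simp [Mem.setWordArr, Function.update_apply]
@[simp] theorem setWordArr_real : (m.setWordArr a i v).real = m.real := rfl
@[simp] theorem setWordArr_realArr : (m.setWordArr a i v).realArr = m.realArr := rfl
@[simp] theorem setReal_word : (m.setReal u r).word = m.word := rfl
@[simp] theorem setReal_wordArr : (m.setReal u r).wordArr = m.wordArr := rfl
@[simp] theorem setReal_real : (m.setReal u r).real v = if v = u then r else m.real v := by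
  simp [Mem.setReal, Function.update_apply]
@[simp] theorem setReal_realArr : (m.setReal u r).realArr = m.realArr := rfl
@[simp] theorem setRealArr_word : (m.setRealArr a i r).word = m.word := rfl
@[simp] theorem setRealArr_wordArr : (m.setRealArr a i r).wordArr = m.wordArr := rfl
@[simp] theorem setRealArr_real : (m.setRealArr a i r).real = m.real := rfl
@[simp] theorem setRealArr_realArr : (m.setRealArr a i r).realArr b =
    if b = a then Function.update (m.realArr a) i r else m.realArr b := by
  simp [Mem.setRealArr, Function.update_apply]
@[simp] theorem bump_word : (m.bump x).word y =
    if y = x then m.word x + 1 else if y = 2 then 1 else m.word y := by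
  simp [Mem.bump]
@[simp] theorem bump_wordArr : (m.bump x).wordArr = m.wordArr := rfl
@[simp] theorem bump_real : (m.bump x).real = m.real := rfl
@[simp] theorem bump_realArr : (m.bump x).realArr = m.realArr := rfl

end Simp

theorem agree_setWord (m : Mem) (x v : ℕ) : Agree [.word x] m (m.setWord x v) := by
  constructor <;> intro y hy <;> simp_all

theorem agree_bump (m : Mem) (x : ℕ) : Agree [.word x, .word 2] m (m.bump x) := by
  constructor <;> intro y hy <;> simp_all

theorem Instr.agree_of_mem_support {i : Instr} {m m' : Mem} (h : m' ∈ (i.exec m).support) :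
    Agree [i.target] m m' := by
  cases i with
  | wordRand x y =>
    rw [Instr.exec_wordRand] at h
    obtain ⟨r, -, rfl⟩ := (PMF.mem_support_map_iff _ _ _).1 h
    exact agree_setWord ..
  | _ =>
    simp only [Instr.exec, PMF.mem_support_pure_iff] at h
    subst h
    constructor <;> intro y hy <;> simp_all [Instr.target]

theorem Instr.agree_eval (i : Instr) (m : Mem) : Agree [i.target] m (i.eval m) := by
  cases i <;> constructor <;> intro y hy <;> simp_all [Instr.target, Instr.eval]

theorem agree_iterRun {L : List Loc} {f : Mem → PMF Mem}
    (hf : ∀ m, ∀ m' ∈ (f m).support, Agree L m m') (k : ℕ) (m m' : Mem)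
    (h : m' ∈ (iterRun f k m).support) : Agree L m m' := by
  induction k generalizing m with
  | zero =>
    simp only [iterRun, PMF.mem_support_pure_iff] at h
    exact h ▸ Agree.refl L m
  | succ k ih =>
    obtain ⟨m₁, h₁, h₂⟩ := (PMF.mem_support_bind_iff _ _ _).1 h
    exact (hf m m₁ h₁).trans (ih m₁ h₂)

namespace Code

theorem agree_round {x y : ℕ} {p : Code} {m m' m'' : Mem} (h : Agree p.targets m m')
    (h' : m'' = m'.bump x) : Agree (loop x y p).targets m m'' := by
  subst h'
  exact (h.mono (by simp [targets])).trans ((agree_bump m' x).mono (by simp [targets]))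

theorem agree_of_mem_support (c : Code) (m m' : Mem) (h : m' ∈ (c.run m).support) :
    Agree c.targets m m' := by
  induction c generalizing m m' with
  | skip =>
    simp only [run, PMF.mem_support_pure_iff] at h
    exact h ▸ Agree.refl _ _
  | instr i => exact Instr.agree_of_mem_support h
  | seq p q hp hq =>
    obtain ⟨m₁, h₁, h₂⟩ := (PMF.mem_support_bind_iff _ _ _).1 h
    exact ((hp m m₁ h₁).mono (by simp [targets])).trans ((hq m₁ m' h₂).mono (by simp [targets]))
  | ite t p q hp hq =>
    simp only [run] at h
    split_ifs at h
    · exact (hp m m' h).mono (by simp [targets])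
    · exact (hq m m' h).mono (by simp [targets])
  | loop x y p hp =>
    refine ((agree_setWord m x 0).mono (by simp [targets])).trans
      (agree_iterRun (fun m₁ m₂ h₂ => ?_) _ _ _ h)
    obtain ⟨m₃, h₃, h₄⟩ := (PMF.mem_support_map_iff _ _ _).1 h₂
    exact agree_round (hp m₁ m₃ h₃) h₄.symm

theorem agree_iterate {L : List Loc} {f : Mem → Mem} (hf : ∀ m, Agree L m (f m)) (k : ℕ) (m : Mem) :
    Agree L m (f^[k] m) := by
  induction k with
  | zero => exact Agree.refl L m
  | succ k ih => rw [Function.iterate_succ_apply']; exact ih.trans (hf _)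

theorem agree_eval (c : Code) (m : Mem) : Agree c.targets m (c.eval m) := by
  induction c generalizing m with
  | skip => exact Agree.refl _ m
  | instr i => exact i.agree_eval m
  | seq p q hp hq =>
    exact ((hp m).mono (by simp [targets])).trans ((hq _).mono (by simp [targets]))
  | ite t p q hp hq =>
    simp only [eval]
    split_ifs
    · exact (hp m).mono (by simp [targets])
    · exact (hq m).mono (by simp [targets])
  | loop x y p hp =>
    exact ((agree_setWord m x 0).mono (by simp [targets])).trans
      (agree_iterate (fun m₁ => agree_round (hp m₁) rfl) _ _)

theorem run_eq_pure {c : Code} (h : c.NoRand) (m : Mem) : c.run m = PMF.pure (c.eval m) := by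
  induction c generalizing m with
  | skip => rfl
  | instr i => exact Instr.exec_eq_pure h m
  | seq p q hp hq =>
    simp only [NoRand, Bool.and_eq_true] at h
    simp [run, eval, hp h.1, hq h.2]
  | ite t p q hp hq =>
    simp only [NoRand, Bool.and_eq_true] at h
    simp only [run, eval]
    split_ifs
    · exact hp h.1 m
    · exact hq h.2 m
  | loop x y p hp =>
    simp only [run, eval]
    generalize m.word y = k
    generalize m.setWord x 0 = m
    induction k generalizing m with
    | zero => rfl
    | succ k ih => simpa [iterRun, hp h, PMF.pure_map] using ih _

/-- The invariant rule for counting loops without random choices: in round `i` the counter is `i`,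
and whatever the loop does not write to is as before the loop. -/
theorem eval_loop_induction {x y : ℕ} {p : Code} {m : Mem} (I : ℕ → Mem → Prop)
    (hx : Loc.word x ∉ p.targets)
    (h0 : I 0 (m.setWord x 0))
    (hs : ∀ i m', i < m.word y → m'.word x = i → Agree (loop x y p).targets m m' → I i m' →
      I (i + 1) ((p.eval m').bump x)) :
    I (m.word y) ((loop x y p).eval m) := by
  have key : ∀ k ≤ m.word y, ∀ m', m' = (fun m' => (p.eval m').bump x)^[k] (m.setWord x 0) →
      m'.word x = k ∧ Agree (loop x y p).targets m m' ∧ I k m' := by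
    intro k
    induction k with
    | zero =>
      rintro - m' rfl
      exact ⟨by simp, (agree_setWord m x 0).mono (by simp [targets]), h0⟩
    | succ k ih =>
      rintro hk m' rfl
      obtain ⟨h1, h2, h3⟩ := ih (by omega) _ rfl
      rw [Function.iterate_succ_apply']
      refine ⟨?_, h2.trans (agree_round (p.agree_eval _) rfl), hs k _ (by omega) h1 h2 h3⟩
      simp [(p.agree_eval _).word x hx, h1]
  exact (key _ le_rfl _ rfl).2.2

end Code

/-! ### Running time of structured programs on the machine -/

/-- The halted configurations with memory in `S`. -/
def haltedIn (S : Set Mem) : Set Config := {σ | σ.Halted ∧ σ.mem ∈ S}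

/-- The program `P` started on `m` ends within `T` steps in every case, with memory distributed as
`μ`. This is phrased through the probability of having halted in a given set, because the random
choices may affect the number of steps. -/
def Runs (P : Program) (m : Mem) (T : ℕ) (μ : PMF Mem) : Prop :=
  ∀ (k : List Program) (s : ℕ) (S : Set Mem),
    (μ.bind fun m' => steps s ⟨k, m'⟩).toOuterMeasure (haltedIn S) ≤
      (steps (T + s) ⟨P :: k, m⟩).toOuterMeasure (haltedIn S)

theorem toOuterMeasure_bind_mono {α β : Type*} (μ : PMF α) {f g : α → PMF β} {s : Set β}
    (h : ∀ a ∈ μ.support, (f a).toOuterMeasure s ≤ (g a).toOuterMeasure s) :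
    (μ.bind f).toOuterMeasure s ≤ (μ.bind g).toOuterMeasure s := by
  simp only [PMF.toOuterMeasure_bind_apply]
  refine ENNReal.tsum_le_tsum fun a => ?_
  by_cases ha : μ a = 0
  · simp [ha]
  · exact mul_le_mul_right (h a ha) _

theorem halted_le_steps_succ (s : ℕ) (c : Config) (S : Set Mem) :
    (steps s c).toOuterMeasure (haltedIn S) ≤ (steps (s + 1) c).toOuterMeasure (haltedIn S) := by
  classical
  induction s generalizing c with
  | zero =>
    by_cases hc : c ∈ haltedIn S
    · obtain ⟨k, m⟩ := c
      obtain rfl : k = [] := hc.1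
      simp [steps, step]
    · simp [steps, PMF.toOuterMeasure_pure_apply, hc]
  | succ s ih =>
    exact toOuterMeasure_bind_mono (step c) fun c' _ => ih c'

theorem halted_mono_steps {s t : ℕ} (h : s ≤ t) (c : Config) (S : Set Mem) :
    (steps s c).toOuterMeasure (haltedIn S) ≤ (steps t c).toOuterMeasure (haltedIn S) :=
  monotone_nat_of_le_succ (f := fun s => (steps s c).toOuterMeasure (haltedIn S))
    (fun s => halted_le_steps_succ s c S) h

namespace Runs

variable {P Q : Program} {m : Mem} {T T' : ℕ} {μ : PMF Mem}

theorem mono (h : Runs P m T μ) (hT : T ≤ T') : Runs P m T' μ := fun k s S =>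
  (h k s S).trans (halted_mono_steps (by omega) _ S)

theorem skip (m : Mem) : Runs .skip m 1 (PMF.pure m) := fun k s S => by
  rw [add_comm]; simp [steps, step]

theorem instr (i : Instr) (m : Mem) : Runs (.instr i) m 1 (i.exec m) := fun k s S => by
  rw [add_comm]; simp [steps, step, PMF.bind_map, Function.comp_def]

theorem seq {ν : Mem → PMF Mem} (hP : Runs P m T μ) (hQ : ∀ m' ∈ μ.support, Runs Q m' T' (ν m')) :
    Runs (.seq P Q) m (1 + T + T') (μ.bind ν) := fun k s S => by
  have : 1 + T + T' + s = (T + (T' + s)) + 1 := by ring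
  rw [this]
  simp only [steps, step, PMF.pure_bind, PMF.bind_bind]
  exact (toOuterMeasure_bind_mono μ fun m' hm' => hQ m' hm' k s S).trans (hP (Q :: k) (T' + s) S)

theorem ite_pos {t : Test} (ht : t.holds m) (h : Runs P m T μ) : Runs (.ite t P Q) m (1 + T) μ :=
  fun k s S => by
  have : 1 + T + s = (T + s) + 1 := by ring
  rw [this]
  simpa [steps, step, ht] using h k s S

theorem ite_neg {t : Test} (ht : ¬ t.holds m) (h : Runs Q m T μ) : Runs (.ite t P Q) m (1 + T) μ :=
  fun k s S => by
  have : 1 + T + s = (T + s) + 1 := by ring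
  rw [this]
  simpa [steps, step, ht] using h k s S

theorem while_done {t : Test} (ht : ¬ t.holds m) : Runs (.while t P) m 1 (PMF.pure m) :=
  fun k s S => by
  rw [add_comm]; simp [steps, step, ht]

theorem while_round {t : Test} {ν : Mem → PMF Mem} (ht : t.holds m) (h : Runs P m T μ)
    (h' : ∀ m' ∈ μ.support, Runs (.while t P) m' T' (ν m')) :
    Runs (.while t P) m (1 + T + T') (μ.bind ν) := fun k s S => by
  have : 1 + T + T' + s = (T + (T' + s)) + 1 := by ring
  rw [this]
  simp only [steps, step, PMF.pure_bind, PMF.bind_bind, ht, if_true]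
  exact (toOuterMeasure_bind_mono μ fun m' hm' => h' m' hm' k s S).trans (h (_ :: k) (T' + s) S)

end Runs

namespace Code

theorem runs_while {x y : ℕ} {p : Code} {T : ℕ} (hx : Loc.word x ∉ p.targets) (hx2 : x ≠ 2)
    (hy : Loc.word y ∉ (loop x y p).targets)
    {J : Mem → Prop} (hJ : ∀ m, J m → ∀ m', Agree (loop x y p).targets m m' → J m')
    (hp : ∀ m, J m → Runs p.compile m T (p.run m)) (k : ℕ) (m : Mem) (hm : J m)
    (hk : m.word x + k = m.word y) :
    Runs (.while (.word .lt x y)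
      (.seq p.compile (.seq (.instr (.wordConst 2 1)) (.instr (.wordAdd x x 2))))) m
      (1 + k * (T + 5)) (iterRun (fun m' => (p.run m').map (Mem.bump x)) k m) := by
  induction k generalizing m with
  | zero =>
    refine (Runs.while_done ?_).mono (by omega)
    simp only [Test.holds, Cmp.holds]; omega
  | succ k ih =>
    have hbody : Runs (.seq p.compile (.seq (.instr (.wordConst 2 1)) (.instr (.wordAdd x x 2)))) m
        (1 + T + 3) ((p.run m).map (Mem.bump x)) := by
      refine (hp m hm).seq (ν := fun m' => PMF.pure (m'.bump x)) fun m' _ => ?_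
      have := (Runs.instr (.wordConst 2 1) m').seq (Q := .instr (.wordAdd x x 2)) (T' := 1)
        (ν := (Instr.wordAdd x x 2).exec) fun m'' _ => Runs.instr _ _
      simpa [Instr.exec, hx2, Mem.bump] using this
    refine (Runs.while_round (T' := 1 + k * (T + 5)) ?_ hbody fun m' hm' => ?_).mono (by ring_nf; omega)
    · simp only [Test.holds, Cmp.holds]; omega
    · obtain ⟨m₁, h₁, rfl⟩ := (PMF.mem_support_map_iff _ _ _).1 hm'
      have hA := p.agree_of_mem_support m m₁ h₁
      have hA' : Agree (loop x y p).targets m (m₁.bump x) := agree_round hA rfl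
      refine ih _ (hJ m hm _ hA') ?_
      rw [hA'.word y hy]
      simp only [bump_word, if_true, hA.word x hx]
      omega

/-- A structured program runs on the machine within its `cost`, provided that the bounds of its loops
are never written to. -/
theorem runs_compile {N : ℕ → ℕ} (c : Code) (hc : c.CountersOK) {L : List Loc} (hL : c.targets ⊆ L)
    (hlim : ∀ y ∈ c.limits, Loc.word y ∉ L) (m : Mem) (hm : ∀ y ∈ c.limits, m.word y = N y) :
    Runs c.compile m (c.cost N) (c.run m) := by
  induction c generalizing m with
  | skip => exact Runs.skip m
  | instr i => exact Runs.instr i m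
  | seq p q hp hq =>
    simp only [CountersOK, Bool.and_eq_true] at hc
    simp only [targets, List.append_subset] at hL
    simp only [limits, List.mem_append] at hlim hm
    refine (hp hc.1 hL.1 (fun y hy => hlim y (.inl hy)) m fun y hy => hm y (.inl hy)).seq
      fun m' hm' => hq hc.2 hL.2 (fun y hy => hlim y (.inr hy)) m' fun y hy => ?_
    rw [(p.agree_of_mem_support m m' hm').word y fun hh => hlim y (.inr hy) (hL.1 hh)]
    exact hm y (.inr hy)
  | ite t p q hp hq =>
    simp only [CountersOK, Bool.and_eq_true] at hc
    simp only [targets, List.append_subset] at hL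
    simp only [limits, List.mem_append] at hlim hm
    simp only [run]
    split_ifs with ht
    · exact (Runs.ite_pos ht (hp hc.1 hL.1 (fun y hy => hlim y (.inl hy)) m
        fun y hy => hm y (.inl hy))).mono (by simp only [cost]; omega)
    · exact (Runs.ite_neg ht (hq hc.2 hL.2 (fun y hy => hlim y (.inr hy)) m
        fun y hy => hm y (.inr hy))).mono (by simp only [cost]; omega)
  | loop x y p hp =>
    simp only [CountersOK, Bool.and_eq_true, decide_eq_true_eq] at hc
    have hy : Loc.word y ∉ (loop x y p).targets := fun hh => hlim y (by simp [limits]) (hL hh)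
    have hyx : y ≠ x := by rintro rfl; exact hy (by simp [targets])
    have hx0 : ∀ z ∈ (loop x y p).limits, (m.setWord x 0).word z = N z := fun z hz => by
      rw [← hm z hz]
      exact (agree_setWord m x 0).word z fun hh => hlim z hz (hL (by simp_all [targets]))
    have hw := runs_while (p := p) (T := p.cost N) hc.1.2 hc.2 hy
      (J := fun m' => ∀ z ∈ (loop x y p).limits, m'.word z = N z)
      (fun m₁ h₁ m₂ h₂ z hz => by
        rw [h₂.word z fun hh => hlim z hz (hL hh)]; exact h₁ z hz)
      (fun m₁ h₁ => hp hc.1.1 (fun l hl => hL (by simp [targets, hl]))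
        (fun z hz => hlim z (by simp [limits, hz])) m₁ fun z hz => h₁ z (by simp [limits, hz]))
      (m.word y) (m.setWord x 0) hx0 (by simp [hyx])
    have := (Runs.instr (.wordConst x 0) m).seq (T' := 1 + m.word y * (p.cost N + 5))
      (ν := iterRun (fun m' => (p.run m').map (Mem.bump x)) (m.word y)) fun m' hm' => by
        simp only [Instr.exec, PMF.mem_support_pure_iff] at hm'
        subst hm'
        exact hw
    simp only [Instr.exec, PMF.pure_bind] at this
    refine this.mono ?_
    rw [hm y (by simp [limits])]
    simp only [cost]; omega

end Code

/-! ### Gram kernels and pivoting -/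

open Finset

variable {X : Type*}

/-- The kernel that is the Gram matrix of an embedding with `b` placed at the origin, if there is an
embedding. -/
def gram (R : DistanceSpace X) (b x y : X) : ℝ :=
  (R.dist x b * R.dist x b + R.dist y b * R.dist y b - R.dist x y * R.dist x y) / 2

/-- One step of symmetric Gaussian elimination. On Gram matrices this projects all points to the
orthogonal complement of the point `b`. -/
def pivot (g : X → X → ℝ) (b x y : X) : ℝ := g x y - g x b * g y b / g b b

/-- The kernel `g` is what remains of the distances after splitting off `t` Euclidean coordinates. -/
def Remainder (R : DistanceSpace X) (t : ℕ) (g : X → X → ℝ) : Prop :=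
  (∀ x y, g x y = g y x) ∧ ∃ φ : ℕ → X → ℝ, ∀ x y,
    R.dist x y ^ 2 = ∑ i ∈ range t, (φ i x - φ i y) ^ 2 + (g x x + g y y - 2 * g x y)

theorem remainder_gram (R : DistanceSpace X) (b : X) : Remainder R 0 (gram R b) := by
  refine ⟨fun x y => ?_, fun _ _ => 0, fun x y => ?_⟩
  · simp only [gram, R.dist_symm x y]; ring
  · simp only [gram, R.dist_self]; simp; ring

theorem Remainder.mono {R : DistanceSpace X} {s t : ℕ} {g : X → X → ℝ} (h : Remainder R s g)
    (hst : s ≤ t) : Remainder R t g := by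
  obtain ⟨hs, φ, hφ⟩ := h
  refine ⟨hs, fun i x => if i < s then φ i x else 0, fun x y => ?_⟩
  rw [hφ x y, ← sum_subset (range_mono hst)]
  · congr 1
    exact sum_congr rfl fun i hi => by simp only [if_pos (mem_range.1 hi)]
  · intro i _ hi
    simp [mem_range] at hi
    simp [hi.not_gt]

theorem Remainder.pivot {R : DistanceSpace X} {t : ℕ} {g : X → X → ℝ} (h : Remainder R t g) {b : X}
    (hb : 0 < g b b) : Remainder R (t + 1) (pivot g b) := by
  obtain ⟨hs, φ, hφ⟩ := h
  refine ⟨fun x y => ?_, fun i x => if i < t then φ i x else g x b / √(g b b), fun x y => ?_⟩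
  · simp only [RealRAM.pivot, hs x y]; ring
  · have h0 : ∑ i ∈ range t, ((if i < t then φ i x else g x b / √(g b b)) -
        (if i < t then φ i y else g y b / √(g b b))) ^ 2 = ∑ i ∈ range t, (φ i x - φ i y) ^ 2 :=
      sum_congr rfl fun i hi => by rw [if_pos (mem_range.1 hi), if_pos (mem_range.1 hi)]
    rw [hφ x y, sum_range_succ, h0]
    have h1 : √(g b b) ^ 2 = g b b := Real.sq_sqrt hb.le
    simp only [lt_irrefl, if_false, RealRAM.pivot, ← sub_div, div_pow, h1]
    field_simp
    ring

/-- Where the remainder vanishes, the coordinates split off form an isometric embedding. -/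
theorem Remainder.isOutlierSet {R : DistanceSpace X} {d : ℕ} {g : X → X → ℝ} (h : Remainder R d g)
    {D : Finset X} (hD : ∀ x ∉ D, ∀ y ∉ D, g x y = 0) : R.IsOutlierSet d D := by
  obtain ⟨-, φ, hφ⟩ := h
  refine ⟨fun x => WithLp.toLp 2 fun i => φ i x, fun x y => ?_⟩
  rw [EuclideanSpace.norm_eq, eq_comm, Real.sqrt_eq_iff_eq_sq (by positivity)]
  · have := hφ x y
    rw [hD x x.2 x x.2, hD y y.2 y y.2, hD x x.2 y y.2] at this
    simp only [DistanceSpace.restrict, this, ← Fin.sum_univ_eq_sum_range (fun i => (φ i x - φ i y) ^ 2)]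
    simp
  · exact R.dist_nonneg _ _

/-- On the complement of `O`, the kernel `g` is a Gram matrix of vectors of `E` that span at most `q`
dimensions. -/
def SpansOff (E : Type*) [NormedAddCommGroup E] [InnerProductSpace ℝ E] (O : Finset X) (q : ℕ)
    (g : X → X → ℝ) : Prop :=
  ∃ (v : X → E) (W : Submodule ℝ E), Module.finrank ℝ W ≤ q ∧ (∀ x ∉ O, v x ∈ W) ∧
    ∀ x ∉ O, ∀ y ∉ O, g x y = inner ℝ (v x) (v y)

theorem spansOff_gram [Fintype X] {R : DistanceSpace X} {d : ℕ} {O : Finset X}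
    (hO : R.IsOutlierSet d O) {b : X} (hb : b ∉ O) :
    SpansOff (EuclideanSpace ℝ (Fin d)) O (min d (Fintype.card X)) (gram R b) := by
  classical
  obtain ⟨φ, hφ⟩ := hO
  set v : X → EuclideanSpace ℝ (Fin d) := fun x => if h : x ∉ O then φ ⟨x, h⟩ - φ ⟨b, hb⟩ else 0
    with hv
  refine ⟨v, Submodule.span ℝ (Set.range v), le_min ?_ (finrank_range_le_card v),
    fun x _ => Submodule.subset_span ⟨x, rfl⟩, fun x hx y hy => ?_⟩
  · exact (Submodule.finrank_le _).trans (by simp)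
  · have h1 : ∀ x (hx : x ∉ O) y (hy : y ∉ O), R.dist x y = ‖φ ⟨x, hx⟩ - φ ⟨y, hy⟩‖ :=
      fun x hx y hy => hφ ⟨x, hx⟩ ⟨y, hy⟩
    have h2 : φ ⟨x, hx⟩ - φ ⟨y, hy⟩ = v x - v y := by simp [hv, hx, hy]
    rw [real_inner_eq_norm_mul_self_add_norm_mul_self_sub_norm_sub_mul_self_div_two, ← h2]
    simp only [gram, h1 x hx b hb, h1 y hy b hb, h1 x hx y hy, hv, hx, hy, not_false_eq_true, dif_pos]

section Spans
variable {E : Type*} [NormedAddCommGroup E] [InnerProductSpace ℝ E] {O : Finset X} {q : ℕ}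
  {g : X → X → ℝ}

theorem SpansOff.nonneg (h : SpansOff E O q g) {x : X} (hx : x ∉ O) : 0 ≤ g x x := by
  obtain ⟨v, W, -, -, h3⟩ := h
  rw [h3 x hx x hx]; exact real_inner_self_nonneg

theorem SpansOff.eq_zero (h : SpansOff E O q g) {x y : X} (hx : x ∉ O) (hy : y ∉ O)
    (hxx : g x x = 0) : g x y = 0 := by
  obtain ⟨v, W, -, -, h3⟩ := h
  rw [h3 x hx x hx, inner_self_eq_zero] at hxx
  rw [h3 x hx y hy, hxx, inner_zero_left]

theorem SpansOff.eq_zero_of_zero [FiniteDimensional ℝ E] (h : SpansOff E O 0 g) {x : X}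
    (hx : x ∉ O) : g x x = 0 := by
  obtain ⟨v, W, h1, h2, h3⟩ := h
  obtain rfl : W = ⊥ := Submodule.finrank_eq_zero.1 (Nat.le_zero.1 h1)
  have := (Submodule.mem_bot ℝ).1 (h2 x hx)
  rw [h3 x hx x hx, this, inner_zero_left]

theorem SpansOff.pivot [FiniteDimensional ℝ E] (h : SpansOff E O (q + 1) g) {b : X} (hb : b ∉ O)
    (hbb : g b b ≠ 0) : SpansOff E O q (pivot g b) := by
  obtain ⟨v, W, h1, h2, h3⟩ := h
  rw [h3 b hb b hb] at hbb
  have hsymm : ∀ x y, inner ℝ (v x) (v y) = inner ℝ (v y) (v x) := fun x y => real_inner_comm _ _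
  refine ⟨fun x => v x - (inner ℝ (v x) (v b) / inner ℝ (v b) (v b)) • v b,
    W ⊓ (Submodule.span ℝ {v b})ᗮ, ?_, fun x hx => ⟨?_, ?_⟩, fun x hx y hy => ?_⟩
  · have : W ⊓ (Submodule.span ℝ {v b})ᗮ < W := by
      refine inf_le_left.lt_of_ne fun hh => hbb ?_
      have h4 : v b ∈ W ⊓ (Submodule.span ℝ {v b})ᗮ := hh.symm.le (h2 b hb)
      exact Submodule.mem_orthogonal_singleton_iff_inner_right.1 h4.2
    have := Submodule.finrank_lt_finrank_of_lt this
    omega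
  · exact W.sub_mem (h2 x hx) (W.smul_mem _ (h2 b hb))
  · refine Submodule.mem_orthogonal_singleton_iff_inner_right.2 ?_
    rw [inner_sub_right, inner_smul_right, hsymm b x]
    field_simp
    ring
  · simp only [RealRAM.pivot, h3 x hx y hy, h3 x hx b hb, h3 y hy b hb, h3 b hb b hb,
      inner_sub_left, inner_sub_right, inner_smul_left, inner_smul_right, hsymm b y]
    simp only [conj_trivial]
    field_simp
    ring

end Spans

/-! ### Charging removed points to outliers -/

/-- Removing `D` leaves only points between which `g` vanishes, and at least half of `D` lies in any set
`O` that contains at least half of the points with `g x x ≠ 0` and meets every conflict, that is, every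
pair with `g x y ≠ 0` among the other points. -/
def IsCandidate [Fintype X] [DecidableEq X] (g : X → X → ℝ) (D : Finset X) : Prop :=
  (∀ x ∉ D, ∀ y ∉ D, g x y = 0) ∧ ∀ O : Finset X,
    (∀ x ∉ O, ∀ y ∉ O, g x x = 0 → g y y = 0 → g x y = 0) →
    #{x | g x x ≠ 0 } ≤ 2 * #{x ∈ O | g x x ≠ 0} → #D ≤ 2 * #{x ∈ D | x ∈ O}

theorem charge_insert_pair [DecidableEq X] {D O : Finset X} (h : #D ≤ 2 * #{x ∈ D | x ∈ O})
    {a b : X} (ha : a ∉ D) (hb : b ∉ D) (hO : a ∈ O ∨ b ∈ O) :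
    #(insert b (insert a D)) ≤ 2 * #{x ∈ insert b (insert a D) | x ∈ O} := by
  have h1 : #(insert b (insert a D)) ≤ #D + 2 :=
    (card_insert_le _ _).trans (Nat.add_le_add_right (card_insert_le _ _) 1)
  have h2 : #{x ∈ D | x ∈ O} + 1 ≤ #{x ∈ insert b (insert a D) | x ∈ O} := by
    rcases hO with hO | hO
    · rw [← card_insert_of_notMem (a := a) (s := {x ∈ D | x ∈ O}) (by simp [ha])]
      refine card_le_card fun x => ?_
      simp only [mem_insert, mem_filter]
      rintro (rfl | hx) <;> simp_all
    · rw [← card_insert_of_notMem (a := b) (s := {x ∈ D | x ∈ O}) (by simp [hb])]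
      refine card_le_card fun x => ?_
      simp only [mem_insert, mem_filter]
      rintro (rfl | hx) <;> simp_all
  omega

/-- If `O` contains at least half of the points of positive `g`-norm, a candidate has at most twice the
size of `O`. -/
theorem IsCandidate.card_le [Fintype X] [DecidableEq X] {E : Type*} [NormedAddCommGroup E]
    [InnerProductSpace ℝ E] {O D : Finset X} {q : ℕ} {g : X → X → ℝ} (hD : IsCandidate g D) (h : SpansOff E O q g)
    (hN : #{x | 0 < g x x} ≤ 2 * #{x ∈ O | 0 < g x x}) : #D ≤ 2 * #O := by
  refine (hD.2 O (fun x hx y hy hxx _ => h.eq_zero hx hy hxx) ?_).trans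
    (Nat.mul_le_mul_left 2 (card_le_card fun x hx => (mem_filter.1 hx).2))
  have h1 : #{x | g x x ≠ 0} ≤ #{x | 0 < g x x} + #{x ∈ O | g x x < 0} := by
    refine (card_le_card fun x hx => ?_).trans (card_union_le _ _)
    simp only [mem_filter, mem_univ, true_and, mem_union] at hx ⊢
    rcases hx.lt_or_gt with hx | hx
    · exact .inr ⟨by_contra fun hO => absurd (h.nonneg hO) hx.not_ge, hx⟩
    · exact .inl hx
  have h2 : #{x ∈ O | 0 < g x x} + #{x ∈ O | g x x < 0} ≤ #{x ∈ O | g x x ≠ 0} := by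
    rw [← card_union_of_disjoint]
    · refine card_le_card fun x => ?_
      simp only [mem_union, mem_filter]
      rintro (⟨h, h'⟩ | ⟨h, h'⟩)
      exacts [⟨h, h'.ne'⟩, ⟨h, h'.ne⟩]
    · refine disjoint_filter.2 fun x _ h h' => absurd h h'.not_gt
  omega

/-! ### The program

Integer registers: `0` the number of points, `1` the dimension, `2` the constant `1` of the loops, `3` always
zero, `4` and `5` counter and number of repetitions, `6` and `7` counter and number of stages, `8` the size
of the best outlier set, `9` and `10` points in loops, `13` a count, `14` a base or pivot point, others
scratch. Integer arrays: `0` the best outlier set, `1` the offsets of the rows of a matrix, `2` the current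
candidate, `3` a list of points. Real registers: `0` always zero, `1` the constant `2`, others scratch. Real
arrays: `0` the distances, `1` the kernel, `2` a column of the kernel. -/

open Code (skip ite loop eval targets eval_loop_induction run)
open Instr (wordConst wordAdd wordSub wordLoad wordStore wordRand realConst realOp realLoad realStore)
open scoped ENNReal

/-- Sets up the registers and the row offsets, with all points as the first outlier set. -/
def setup : Code :=
  wordConst 5 2 ;; loop 9 1 (wordAdd 5 5 5) ;; wordConst 2 1 ;; wordAdd 7 1 2 ;; realConst 1 2 ;;
  wordAdd 8 0 3 ;; wordConst 11 0 ;;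
  loop 9 0 (wordStore 1 9 11 ;; wordAdd 11 11 0 ;; wordConst 12 1 ;; wordStore 0 9 12)

/-- Fills the real array `1` with the kernel `gram R b`, for the content `b` of register `14`. -/
def gramCode : Code :=
  loop 9 0 (loop 10 0 (
    wordLoad 11 1 9 ;; wordAdd 11 11 14 ;; realLoad 2 0 11 ;; realOp .mul 2 2 2 ;;
    wordLoad 11 1 10 ;; wordAdd 11 11 14 ;; realLoad 3 0 11 ;; realOp .mul 3 3 3 ;;
    realOp .add 2 2 3 ;;
    wordLoad 11 1 9 ;; wordAdd 11 11 10 ;; realLoad 3 0 11 ;; realOp .mul 3 3 3 ;;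
    realOp .sub 2 2 3 ;; realOp .div 2 2 1 ;; realStore 1 11 2))

/-- Marks in the integer array `2` the points of nonzero norm. -/
def markCode : Code :=
  loop 9 0 (wordLoad 11 1 9 ;; wordAdd 11 11 9 ;; realLoad 2 1 11 ;;
    ite (.real .eq 2 0) (wordStore 2 9 3) (wordConst 12 1 ;; wordStore 2 9 12))

/-- Greedily marks both points of unmarked pairs with nonzero kernel. -/
def matchCode : Code :=
  loop 9 0 (loop 10 0 (
    wordLoad 11 2 9 ;; wordLoad 12 2 10 ;; wordAdd 11 11 12 ;;
    ite (.word .eq 11 3)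
      (wordLoad 11 1 9 ;; wordAdd 11 11 10 ;; realLoad 2 1 11 ;;
        ite (.real .eq 2 0) skip (wordConst 12 1 ;; wordStore 2 9 12 ;; wordStore 2 10 12))
      skip))

/-- Counts the marked points in register `13`. -/
def countCode : Code :=
  wordConst 13 0 ;; loop 9 0 (wordLoad 11 2 9 ;; wordAdd 13 13 11)

/-- Outputs the marked set if it is smaller than the best set so far, of size in register `8`. -/
def updateCode : Code :=
  ite (.word .lt 13 8) (wordAdd 8 13 3 ;; loop 9 0 (wordLoad 11 2 9 ;; wordStore 0 9 11)) skip

/-- Lists the points of positive norm in the integer array `3`, and their number in register `13`. -/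
def collectCode : Code :=
  wordConst 13 0 ;;
  loop 9 0 (wordLoad 11 1 9 ;; wordAdd 11 11 9 ;; realLoad 2 1 11 ;;
    ite (.real .lt 0 2) (wordStore 3 13 9 ;; wordConst 12 1 ;; wordAdd 13 13 12) skip)

/-- Replaces the kernel `g` by `pivot g b`, for the content `b` of register `14`. -/
def pivotCode : Code :=
  loop 9 0 (wordLoad 11 1 9 ;; wordAdd 11 11 14 ;; realLoad 2 1 11 ;; realStore 2 9 2) ;;
  realLoad 3 2 14 ;;
  loop 9 0 (loop 10 0 (
    realLoad 2 2 9 ;; realLoad 4 2 10 ;; realOp .mul 2 2 4 ;; realOp .div 2 2 3 ;;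
    wordLoad 11 1 9 ;; wordAdd 11 11 10 ;; realLoad 4 1 11 ;; realOp .sub 2 4 2 ;;
    realStore 1 11 2))

/-- The deterministic part of a stage: tries the candidate outlier set that the current kernel gives
and lists the points of positive norm. -/
def tryCode : Code := markCode ;; matchCode ;; countCode ;; updateCode ;; collectCode

/-- Draws a number below the content of register `13`. -/
def drawCode : Code := wordConst 12 1 ;; wordSub 11 13 12 ;; wordRand 15 11

/-- Pivots on the point whose position in the list is in register `15`. -/
def pivotAtCode : Code := wordLoad 14 3 15 ;; pivotCode

/-- One stage: tries a candidate and pivots on a random point of positive norm. -/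
def stageCode : Code := tryCode ;; ite (.word .lt 3 13) (drawCode ;; pivotAtCode) skip

/-- Draws a number below the number of points. -/
def drawBaseCode : Code := wordConst 12 1 ;; wordSub 11 0 12 ;; wordRand 14 11

/-- One repetition: a random base point, and one more stage than there are dimensions, since a candidate
is also needed after the last useful pivot. -/
def repCode : Code := drawBaseCode ;; gramCode ;; loop 6 7 stageCode

/-- Lowers the dimension to the number of points. -/
def clampCode : Code := ite (.word .lt 0 1) (wordAdd 1 0 3) skip

/-- The approximation algorithm. -/
def mainCode : Code := clampCode ;; setup ;; loop 4 5 repCode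

/-! ### Correctness of the deterministic parts -/

/-- The constants and tables that the program relies on after the setup. -/
structure Ready {n : ℕ} (R : DistanceSpace (Fin n)) (d : ℕ) (m : Mem) : Prop where
  size : m.word 0 = n
  zero : m.word 3 = 0
  reps : m.word 5 = 2 ^ (d + 1)
  stages : m.word 7 = d + 1
  realZero : m.real 0 = 0
  realTwo : m.real 1 = 2
  row : ∀ i < n, m.wordArr 1 i = i * n
  input : ∀ i j : Fin n, m.realArr 0 (i * n + j) = R.dist i j

/-- The real array `1` holds the kernel `g`. -/
def Stored {n : ℕ} (m : Mem) (g : Fin n → Fin n → ℝ) : Prop :=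
  ∀ i j : Fin n, m.realArr 1 (i * n + j) = g i j

/-- No location in `L` is one that `Ready` speaks about. -/
def KeepsReady (L : List Loc) : Prop :=
  ∀ l ∈ [Loc.word 0, .word 3, .word 5, .word 7, .real 0, .real 1, .wordArr 1, .realArr 0], l ∉ L

instance (L : List Loc) : Decidable (KeepsReady L) := by unfold KeepsReady; infer_instance

theorem Ready.agree {n d : ℕ} {R : DistanceSpace (Fin n)} {L : List Loc} {m m' : Mem}
    (h : Ready R d m) (hA : Agree L m m') (hL : KeepsReady L) : Ready R d m' := by
  simp only [KeepsReady, List.forall_mem_cons] at hL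
  obtain ⟨h1, h2, h3, h4, h5, h6, h7, h8, -⟩ := hL
  exact ⟨hA.word _ h1 ▸ h.size, hA.word _ h2 ▸ h.zero, hA.word _ h3 ▸ h.reps, hA.word _ h4 ▸ h.stages,
    hA.real _ h5 ▸ h.realZero, hA.real _ h6 ▸ h.realTwo, hA.wordArr _ h7 ▸ h.row,
    hA.realArr _ h8 ▸ h.input⟩

theorem Stored.agree {n : ℕ} {g : Fin n → Fin n → ℝ} {L : List Loc} {m m' : Mem}
    (h : Stored m g) (hA : Agree L m m') (hL : Loc.realArr 1 ∉ L) : Stored m' g := by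
  unfold Stored
  rw [hA.realArr _ hL]; exact h

theorem cell_inj {n a b i j : ℕ} (hb : b < n) (hj : j < n) :
    a * n + b = i * n + j ↔ a = i ∧ b = j := by
  refine ⟨fun h => ?_, fun ⟨h1, h2⟩ => by rw [h1, h2]⟩
  have h1 : (a * n + b) / n = a := by
    rw [mul_comm, Nat.mul_add_div (by omega), Nat.div_eq_of_lt hb, add_zero]
  have h2 : (i * n + j) / n = i := by
    rw [mul_comm, Nat.mul_add_div (by omega), Nat.div_eq_of_lt hj, add_zero]
  have h3 : a = i := by rw [← h1, h, h2]
  subst h3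
  exact ⟨rfl, by omega⟩

theorem cell_lt {n a b : ℕ} (ha : a < n) (hb : b < n) : a * n + b < n * n :=
  calc a * n + b < a * n + n := by omega
    _ = (a + 1) * n := by ring
    _ ≤ n * n := Nat.mul_le_mul_right n ha

/-- The invariant rule for two nested loops over all points. The invariant speaks about the number of
pairs dealt with so far and the contents of the arrays. -/
theorem eval_loop_pairs {n : ℕ} {p : Code} {m : Mem} (hn : m.word 0 = n)
    (I : ℕ → (ℕ → ℕ → ℕ) → (ℕ → ℕ → ℝ) → Prop)
    (h9 : Loc.word 9 ∉ p.targets) (h10 : Loc.word 10 ∉ p.targets) (hp0 : Loc.word 0 ∉ p.targets)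
    (h0 : I 0 m.wordArr m.realArr)
    (hs : ∀ i j m', i < n → j < n → m'.word 9 = i → m'.word 10 = j →
      Agree (loop 9 0 (loop 10 0 p)).targets m m' → I (i * n + j) m'.wordArr m'.realArr →
      I (i * n + j + 1) (p.eval m').wordArr (p.eval m').realArr) :
    I (n * n) ((loop 9 0 (loop 10 0 p)).eval m).wordArr
      ((loop 9 0 (loop 10 0 p)).eval m).realArr := by
  have := eval_loop_induction (x := 9) (y := 0) (p := loop 10 0 p) (m := m)
    (fun i m' => I (i * n) m'.wordArr m'.realArr) (by simp [targets, h9]) (by simpa using h0) ?_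
  · rwa [hn] at this
  intro i m₁ hi h₁ hA₁ hI₁
  have hn₁ : m₁.word 0 = n := (hA₁.word 0 (by simp [targets, hp0])).trans hn
  have := eval_loop_induction (x := 10) (y := 0) (p := p) (m := m₁)
    (fun j m' => I (i * n + j) m'.wordArr m'.realArr) h10 (by simpa using hI₁) ?_
  · rw [hn₁] at this
    simpa [add_mul] using this
  intro j m₂ hj h₂ hA₂ hI₂
  simpa [← add_assoc] using hs i j m₂ (hn ▸ hi) (hn₁ ▸ hj)
    ((hA₂.word 9 (by simp [targets, h9])).trans h₁) h₂
    (hA₁.trans (hA₂.mono (by simp [targets]))) hI₂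

/-- Two nested loops that overwrite the kernel entry by entry. -/
theorem stored_of_fill {n : ℕ} {p : Code} {m : Mem} (hn : m.word 0 = n) (F : Fin n → Fin n → ℝ)
    (h9 : Loc.word 9 ∉ p.targets) (h10 : Loc.word 10 ∉ p.targets) (hp0 : Loc.word 0 ∉ p.targets)
    (hs : ∀ (i j : Fin n) (m' : Mem), m'.word 9 = i → m'.word 10 = j →
      Agree (loop 9 0 (loop 10 0 p)).targets m m' →
      m'.realArr 1 (i * n + j) = m.realArr 1 (i * n + j) →
      (p.eval m').realArr 1 = Function.update (m'.realArr 1) (i * n + j) (F i j)) :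
    Stored ((loop 9 0 (loop 10 0 p)).eval m) F := by
  have := eval_loop_pairs (p := p) (m := m) hn (fun k _ ra => ∀ a b : Fin n,
    ra 1 (a * n + b) = if (a * n + b : ℕ) < k then F a b else m.realArr 1 (a * n + b)) h9 h10 hp0
    (by simp) ?_
  · intro a b
    rw [this a b, if_pos (cell_lt a.2 b.2)]
  intro i j m' hi hj h9' h10' hA hI a b
  rw [hs ⟨i, hi⟩ ⟨j, hj⟩ m' h9' h10' hA (by simpa using hI ⟨i, hi⟩ ⟨j, hj⟩), Function.update_apply]
  by_cases hab : (a * n + b : ℕ) = i * n + j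
  · obtain ⟨h1, h2⟩ := (cell_inj b.2 hj).1 hab
    have h1 : a = ⟨i, hi⟩ := Fin.ext h1
    have h2 : b = ⟨j, hj⟩ := Fin.ext h2
    subst h1 h2
    simp
  · rw [if_neg (by simpa using hab), hI a b]
    congr 1
    simp only [eq_iff_iff]
    omega

section Specs

variable {n d : ℕ} {R : DistanceSpace (Fin n)} {m : Mem} {g : Fin n → Fin n → ℝ}

theorem stored_gramCode (hm : Ready R d m) (b : Fin n) (hb : m.word 14 = b) :
    Stored (gramCode.eval m) (gram R b) := by
  refine stored_of_fill hm.size _ (by decide) (by decide) (by decide) fun i j m' h9 h10 hA _ => ?_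
  have hm' := hm.agree hA (by decide)
  have h14 : m'.word 14 = b := (hA.word 14 (by decide)).trans hb
  simp [eval, Instr.eval, RealOp.eval, h9, h10, h14, hm'.row, hm'.input, hm'.realTwo, gram]

theorem stored_pivotCode (hm : Ready R d m) (hg : Stored m g) (b : Fin n) (hb : m.word 14 = b) :
    Stored (pivotCode.eval m) (pivot g b) := by
  unfold pivotCode
  rw [eval, eval]
  set L : Code := loop 9 0 (wordLoad 11 1 9 ;; wordAdd 11 11 14 ;; realLoad 2 1 11 ;; realStore 2 9 2)
  have hA₁ := L.agree_eval m
  have h1 : ∀ i : Fin n, (L.eval m).realArr 2 i = g i b := by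
    have := eval_loop_induction (x := 9) (y := 0)
      (p := wordLoad 11 1 9 ;; wordAdd 11 11 14 ;; realLoad 2 1 11 ;; realStore 2 9 2) (m := m)
      (fun k m' => ∀ i : Fin n, (i : ℕ) < k → m'.realArr 2 i = g i b) (by decide) (by simp) ?_
    · rw [hm.size] at this
      exact fun i => this i i.2
    intro k m' hk h9 hA hI i hi
    have hm' := hm.agree hA (by decide)
    have hg' := hg.agree hA (by decide)
    have h14 : m'.word 14 = b := (hA.word 14 (by decide)).trans hb
    rw [hm.size] at hk
    by_cases hik : (i : ℕ) = k
    · have := hg' i b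
      have hr := hm'.row i i.2
      simp [eval, Instr.eval, h9, h14, hr, hik.symm, this]
    · simp [eval, Instr.eval, h9, hik, hI i (by omega)]
  set m₁ := L.eval m
  have hm₁ : Ready R d m₁ := hm.agree hA₁ (by decide)
  have hg₁ : Stored m₁ g := hg.agree hA₁ (by decide)
  have hb₁ : m₁.word 14 = b := (hA₁.word 14 (by decide)).trans hb
  rw [eval, eval]
  set m₂ := Instr.eval (realLoad 3 2 14) m₁ with hm₂_def
  have hA₂ : Agree [.real 3] m₁ m₂ := Instr.agree_eval (realLoad 3 2 14) m₁
  have hm₂ : Ready R d m₂ := hm₁.agree hA₂ (by decide)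
  have hg₂ : Stored m₂ g := hg₁.agree hA₂ (by decide)
  have h3 : m₂.real 3 = g b b := by simp [hm₂_def, Instr.eval, hb₁, h1]
  refine stored_of_fill hm₂.size _ (by decide) (by decide) (by decide) fun i j m' h9 h10 hA hc => ?_
  have hm' := hm₂.agree hA (by decide)
  have h3' : m'.real 3 = g b b := (hA.real 3 (by decide)).trans h3
  have h2' : ∀ i : Fin n, m'.realArr 2 i = g i b := fun i => by
    rw [hA.realArr 2 (by decide)]; exact h1 i
  rw [hg₂ i j] at hc
  simp [eval, Instr.eval, RealOp.eval, h9, h10, h2', h3', hm'.row, hc, pivot]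

/-- The integer array `2` marks the set `D`. -/
def Marked (m : Mem) (D : Finset (Fin n)) : Prop :=
  ∀ i : Fin n, m.wordArr 2 i = if i ∈ D then 1 else 0

theorem Marked.agree {D : Finset (Fin n)} {L : List Loc} {m m' : Mem}
    (h : Marked m D) (hA : Agree L m m') (hL : Loc.wordArr 2 ∉ L) : Marked m' D := by
  unfold Marked
  rw [hA.wordArr _ hL]; exact h

theorem marked_markCode (hm : Ready R d m) (hg : Stored m g) :
    Marked (markCode.eval m) {x | g x x ≠ 0} := by
  have := eval_loop_induction (x := 9) (y := 0)
    (p := wordLoad 11 1 9 ;; wordAdd 11 11 9 ;; realLoad 2 1 11 ;;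
      ite (.real .eq 2 0) (wordStore 2 9 3) (wordConst 12 1 ;; wordStore 2 9 12)) (m := m)
    (fun k m' => ∀ i : Fin n, (i : ℕ) < k → m'.wordArr 2 i = if g i i ≠ 0 then 1 else 0)
    (by decide) (by simp) ?_
  · rw [hm.size] at this
    intro i
    simpa [markCode] using this i i.2
  intro k m' hk h9 hA hI i hi
  have hm' := hm.agree hA (by decide)
  have hg' := hg.agree hA (by decide)
  rw [hm.size] at hk
  have hc := hg' ⟨k, hk⟩ ⟨k, hk⟩
  simp only at hc
  by_cases hik : (i : ℕ) = k
  · obtain rfl : i = ⟨k, hk⟩ := Fin.ext hik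
    by_cases h0 : g ⟨k, hk⟩ ⟨k, hk⟩ = 0 <;>
    simp [eval, Instr.eval, Test.holds, Cmp.holds, h9, hm'.row k hk, hc, hm'.zero, hm'.realZero, h0]
  · by_cases h0 : g ⟨k, hk⟩ ⟨k, hk⟩ = 0 <;>
    simp [eval, Instr.eval, Test.holds, Cmp.holds, h9, hm'.row k hk, hc, hm'.zero, hm'.realZero, h0,
      hik, hI i (by omega)]

theorem marked_matchCode (hm : Ready R d m) (hg : Stored m g)
    (hD : Marked m {x : Fin n | g x x ≠ 0}) :
    ∃ D : Finset (Fin n), IsCandidate g D ∧ Marked (matchCode.eval m) D := by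
  have := eval_loop_pairs (m := m) (p := wordLoad 11 2 9 ;; wordLoad 12 2 10 ;; wordAdd 11 11 12 ;;
    ite (.word .eq 11 3)
      (wordLoad 11 1 9 ;; wordAdd 11 11 10 ;; realLoad 2 1 11 ;;
        ite (.real .eq 2 0) skip (wordConst 12 1 ;; wordStore 2 9 12 ;; wordStore 2 10 12))
      skip) hm.size
    (fun k wa _ => ∃ D : Finset (Fin n), (∀ i : Fin n, wa 2 i = if i ∈ D then 1 else 0) ∧
      (∀ x ∉ D, g x x = 0) ∧
      (∀ a ∉ D, ∀ b ∉ D, (a * n + b : ℕ) < k → g a b = 0) ∧ ∀ O : Finset (Fin n),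
      (∀ x ∉ O, ∀ y ∉ O, g x x = 0 → g y y = 0 → g x y = 0) →
      #{x | g x x ≠ 0 } ≤ 2 * #{x ∈ O | g x x ≠ 0} → #D ≤ 2 * #{x ∈ D | x ∈ O})
    (by decide) (by decide) (by decide) ?_ ?_
  · obtain ⟨D, h1, -, h2, h3⟩ := this
    exact ⟨D, ⟨fun x hx y hy => h2 x hx y hy (cell_lt x.2 y.2), h3⟩, h1⟩
  · refine ⟨univ.filter fun x => g x x ≠ 0, hD, by simp, by simp, fun O _ h => h.trans_eq ?_⟩
    congr 2
    ext x
    simp [and_comm]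
  intro i j m' hi hj h9 h10 hA ⟨D, h1, h2, h3, h4⟩
  have hm' := hm.agree hA (by decide)
  have hg' := hg.agree hA (by decide)
  have hi' := h1 ⟨i, hi⟩
  have hj' := h1 ⟨j, hj⟩
  have hc := hg' ⟨i, hi⟩ ⟨j, hj⟩
  simp only at hi' hj' hc
  -- unless a pair is newly marked, the same set works
  have keep : (⟨i, hi⟩ ∉ D → ⟨j, hj⟩ ∉ D → g ⟨i, hi⟩ ⟨j, hj⟩ = 0) →
      ∀ a ∉ D, ∀ b ∉ D, (a * n + b : ℕ) < i * n + j + 1 → g a b = 0 := by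
    intro h a ha b hb hab
    rcases (Nat.lt_succ_iff.1 hab).lt_or_eq with hab | hab
    · exact h3 a ha b hb hab
    · obtain ⟨e1, e2⟩ := (cell_inj b.2 hj).1 hab
      obtain rfl : a = ⟨i, hi⟩ := Fin.ext e1
      obtain rfl : b = ⟨j, hj⟩ := Fin.ext e2
      exact h ha hb
  by_cases hDi : ⟨i, hi⟩ ∈ D
  · refine ⟨D, ?_, h2, keep fun h => absurd hDi h, h4⟩
    simpa [eval, Instr.eval, Test.holds, Cmp.holds, h9, h10, hi', hj', hDi, hm'.zero] using h1
  by_cases hDj : ⟨j, hj⟩ ∈ D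
  · refine ⟨D, ?_, h2, keep fun _ h => absurd hDj h, h4⟩
    simpa [eval, Instr.eval, Test.holds, Cmp.holds, h9, h10, hi', hj', hDi, hDj, hm'.zero] using h1
  by_cases hgij : g ⟨i, hi⟩ ⟨j, hj⟩ = 0
  · refine ⟨D, ?_, h2, keep fun _ _ => hgij, h4⟩
    simpa [eval, Instr.eval, Test.holds, Cmp.holds, h9, h10, hi', hj', hDi, hDj, hm'.zero,
      hm'.row i hi, hc, hgij, hm'.realZero] using h1
  · refine ⟨insert ⟨j, hj⟩ (insert ⟨i, hi⟩ D), fun x => ?_, fun x hx => ?_, fun a ha b hb hab => ?_,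
      fun O hO hO' => ?_⟩
    · simp [eval, Instr.eval, Test.holds, Cmp.holds, h9, h10, hi', hj', hDi, hDj, hm'.zero,
        hm'.row i hi, hc, hgij, hm'.realZero, Function.update_apply, h1 x, Fin.ext_iff]
      split_ifs <;> simp_all
    · simp only [mem_insert, not_or] at hx
      exact h2 x hx.2.2
    · simp only [mem_insert, not_or] at ha hb
      refine h3 a ha.2.2 b hb.2.2 ((Nat.lt_succ_iff.1 hab).lt_of_ne fun hab => ?_)
      exact ha.2.1 (Fin.ext ((cell_inj b.2 hj).1 hab).1)
    · refine charge_insert_pair (h4 O hO hO') hDi hDj ?_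
      by_contra! hh
      exact hgij (hO _ hh.1 _ hh.2 (h2 _ hDi) (h2 _ hDj))

theorem word_countCode (hm : Ready R d m) {D : Finset (Fin n)} (hD : Marked m D) :
    (countCode.eval m).word 13 = #D := by
  have hn : ((wordConst 13 0).eval m).word 0 = n := by simp [Instr.eval, hm.size]
  have := eval_loop_induction (x := 9) (y := 0) (p := wordLoad 11 2 9 ;; wordAdd 13 13 11)
    (m := (wordConst 13 0).eval m)
    (fun k m' => m'.word 13 = #(D.filter fun x : Fin n => (x : ℕ) < k)) (by decide) (by simp [Instr.eval]) ?_
  · rw [hn] at this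
    simpa [countCode, eval] using this
  intro k m' hk h9 hA hI
  have hD' : Marked m' D := (hD.agree (Instr.agree_eval _ m) (by decide)).agree hA (by decide)
  rw [hn] at hk
  have hc := hD' ⟨k, hk⟩
  simp only at hc
  simp only [eval, Instr.eval, bump_word, setWord_word]
  simp only [hI, h9, hc]
  by_cases hkD : ⟨k, hk⟩ ∈ D
  · have : (D.filter fun x : Fin n => (x : ℕ) < k + 1) =
        insert ⟨k, hk⟩ (D.filter fun x : Fin n => (x : ℕ) < k) := by
      ext x
      simp only [mem_filter, mem_insert, Fin.ext_iff]
      constructor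
      · rintro ⟨h1, h2⟩; by_cases x = k <;> [left; right] <;> first | assumption | exact ⟨h1, by omega⟩
      · rintro (h | h)
        · obtain rfl : x = ⟨k, hk⟩ := Fin.ext h
          exact ⟨hkD, by simp⟩
        · exact ⟨h.1, by omega⟩
    rw [this, card_insert_of_notMem (by simp)]
    simp [hkD]
  · have : (D.filter fun x : Fin n => (x : ℕ) < k + 1) = (D.filter fun x : Fin n => (x : ℕ) < k) := by
      refine filter_congr fun x hx => ?_
      have : (x : ℕ) ≠ k := by rintro rfl; exact hkD hx
      omega
    rw [this]
    simp [hkD]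

/-- The output set in a memory. -/
def outSet (n : ℕ) (m : Mem) : Finset (Fin n) := univ.filter fun i : Fin n => m.wordArr 0 i ≠ 0

theorem updateCode_spec (hm : Ready R d m) {D : Finset (Fin n)} (hD : Marked m D)
    (hc : m.word 13 = #D) :
    (updateCode.eval m).word 8 ≤ #D ∧ (updateCode.eval m).word 8 ≤ m.word 8 ∧
    ((updateCode.eval m).word 8 = m.word 8 ∧ outSet n (updateCode.eval m) = outSet n m ∨
      (updateCode.eval m).word 8 = #D ∧ outSet n (updateCode.eval m) = D) := by
  by_cases hlt : #D < m.word 8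
  · set m₁ := (wordAdd 8 13 3).eval m with hm₁_def
    set L : Code := loop 9 0 (wordLoad 11 2 9 ;; wordStore 0 9 11) with hL
    have he : updateCode.eval m = L.eval m₁ := by
      simp [updateCode, eval, Test.holds, Cmp.holds, hc, hlt, hm₁_def, hL]
    have hA₁ : Agree [.word 8] m m₁ := Instr.agree_eval (wordAdd 8 13 3) m
    have hm₁ : m₁.word 0 = n := (hA₁.word 0 (by decide)).trans hm.size
    have h8 : (L.eval m₁).word 8 = #D := by
      rw [(L.agree_eval m₁).word 8 (by decide)]
      simp [hm₁_def, Instr.eval, hc, hm.zero]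
    have := eval_loop_induction (x := 9) (y := 0) (p := wordLoad 11 2 9 ;; wordStore 0 9 11)
      (m := m₁) (fun k m' => ∀ i : Fin n, (i : ℕ) < k → m'.wordArr 0 i = if i ∈ D then 1 else 0)
      (by decide) (by simp) ?_
    · rw [hm₁] at this
      have : outSet n (L.eval m₁) = D := by
        ext i
        simp [outSet, hL, this i i.2]
      rw [he, h8, this]
      exact ⟨le_rfl, hlt.le, .inr ⟨rfl, rfl⟩⟩
    intro k m' hk h9 hA hI i hi
    have hD' : Marked m' D := (hD.agree hA₁ (by decide)).agree hA (by decide)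
    rw [hm₁] at hk
    by_cases hik : (i : ℕ) = k
    · simp [eval, Instr.eval, h9, ← hik, hD' i]
    · simp [eval, Instr.eval, h9, hik, hI i (by omega)]
  · have he : updateCode.eval m = m := by
      simp [updateCode, eval, Test.holds, Cmp.holds, hc, hlt]
    rw [he]
    exact ⟨by omega, le_rfl, .inl ⟨rfl, rfl⟩⟩

/-- The first cells of the integer array `3` enumerate the finite set `N`. -/
def Lists (m : Mem) (N : Finset (Fin n)) : Prop :=
  m.word 13 = #N ∧ (∀ r < #N, ∃ x ∈ N, m.wordArr 3 r = x) ∧ ∀ x ∈ N, ∃ r < #N, m.wordArr 3 r = x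

theorem lists_collectCode (hm : Ready R d m) (hg : Stored m g) :
    Lists (collectCode.eval m) {x : Fin n | 0 < g x x} := by
  have hn : ((wordConst 13 0).eval m).word 0 = n := by simp [Instr.eval, hm.size]
  have := eval_loop_induction (x := 9) (y := 0)
    (p := wordLoad 11 1 9 ;; wordAdd 11 11 9 ;; realLoad 2 1 11 ;;
      ite (.real .lt 0 2) (wordStore 3 13 9 ;; wordConst 12 1 ;; wordAdd 13 13 12) skip)
    (m := (wordConst 13 0).eval m)
    (fun k m' => Lists m' {x : Fin n | (x : ℕ) < k ∧ 0 < g x x}) (by decide)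
    (by simp [Instr.eval, Lists]) ?_
  · rw [hn] at this
    simpa [collectCode, eval] using this
  intro k m' hk h9 hA hI
  have hm' : Ready R d m' := (hm.agree (Instr.agree_eval _ m) (by decide)).agree hA (by decide)
  have hg' : Stored m' g := (hg.agree (Instr.agree_eval _ m) (by decide)).agree hA (by decide)
  rw [hn] at hk
  have hc := hg' ⟨k, hk⟩ ⟨k, hk⟩
  simp only at hc
  by_cases h0 : 0 < g ⟨k, hk⟩ ⟨k, hk⟩
  · have hN : (univ.filter fun x : Fin n => (x : ℕ) < k + 1 ∧ 0 < g x x) =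
        insert ⟨k, hk⟩ (univ.filter fun x : Fin n => (x : ℕ) < k ∧ 0 < g x x) := by
      ext x
      simp only [mem_filter, mem_insert, Fin.ext_iff, mem_univ, true_and]
      constructor
      · rintro ⟨h1, h2⟩; by_cases x = k <;> [left; right] <;> first | assumption | exact ⟨by omega, h2⟩
      · rintro (h | h)
        · obtain rfl : x = ⟨k, hk⟩ := Fin.ext h
          exact ⟨by simp, h0⟩
        · exact ⟨by omega, h.2⟩
    obtain ⟨h1, h2, h3⟩ := hI
    rw [hN]
    set N : Finset (Fin n) := {x : Fin n | (x : ℕ) < k ∧ 0 < g x x}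
    have hcard : #(insert ⟨k, hk⟩ N) = #N + 1 := card_insert_of_notMem (by simp [N])
    unfold Lists
    rw [hcard]
    simp [eval, Instr.eval, Test.holds, Cmp.holds, h9, hm'.row k hk, hc, hm'.realZero, h0, h1,
      Function.update_apply]
    refine ⟨fun r hr => ?_, ⟨#N, by omega, by simp⟩, fun x hx => ?_⟩
    · rcases hr.lt_or_eq with hr | rfl
      · obtain ⟨x, hx, hx'⟩ := h2 r hr
        exact .inr ⟨x, hx, by simp [hr.ne, hx']⟩
      · exact .inl (by simp)
    · obtain ⟨r, hr, hr'⟩ := h3 x hx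
      exact ⟨r, by omega, by simp [hr.ne, hr']⟩
  · have hN : (univ.filter fun x : Fin n => (x : ℕ) < k + 1 ∧ 0 < g x x) =
        univ.filter fun x : Fin n => (x : ℕ) < k ∧ 0 < g x x := by
      refine filter_congr fun x _ => ?_
      refine and_congr_left fun hx => ?_
      have : (x : ℕ) ≠ k := by rintro rfl; exact h0 hx
      omega
    rw [hN]
    simpa [eval, Instr.eval, Test.holds, Cmp.holds, h9, hm'.row k hk, hc, hm'.realZero, h0, Lists]
      using hI

end Specs

/-! ### Probabilities -/

theorem toOuterMeasure_add_compl {α : Type*} (p : PMF α) (s : Set α) :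
    p.toOuterMeasure s + p.toOuterMeasure sᶜ = 1 := by
  rw [PMF.toOuterMeasure_apply, PMF.toOuterMeasure_apply, ← ENNReal.tsum_add, ← p.tsum_coe]
  exact tsum_congr fun x => congrFun (Set.indicator_self_add_compl s p) x

theorem toOuterMeasure_bind_uniform {β : Type*} {k : ℕ} (A : Finset (Fin (k + 1)))
    (hA : k + 1 ≤ 2 * #A) (f : Fin (k + 1) → PMF β) {s : Set β} {q : ℝ≥0∞}
    (h : ∀ r ∈ A, q ≤ (f r).toOuterMeasure s) :
    2⁻¹ * q ≤ ((PMF.uniformOfFintype (Fin (k + 1))).bind f).toOuterMeasure s := by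
  rw [PMF.toOuterMeasure_bind_apply]
  have h1 : (2 : ℝ≥0∞)⁻¹ ≤ #A * ((k + 1 : ℕ) : ℝ≥0∞)⁻¹ := by
    rw [← div_eq_mul_inv, ENNReal.le_div_iff_mul_le (by simp) (by simp), mul_comm,
      ← div_eq_mul_inv]
    refine ENNReal.div_le_of_le_mul' ?_
    exact_mod_cast hA
  calc 2⁻¹ * q ≤ #A * ((k + 1 : ℕ) : ℝ≥0∞)⁻¹ * q := mul_le_mul_left h1 q
    _ = ∑ r ∈ A, ((k + 1 : ℕ) : ℝ≥0∞)⁻¹ * q := by rw [sum_const, nsmul_eq_mul, mul_assoc]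
    _ ≤ ∑ r ∈ A, PMF.uniformOfFintype (Fin (k + 1)) r * (f r).toOuterMeasure s :=
        sum_le_sum fun r hr => by
          rw [PMF.uniformOfFintype_apply, Fintype.card_fin]
          exact mul_le_mul_right (h r hr) _
    _ ≤ _ := ENNReal.sum_le_tsum A

theorem mem_support_iterRun {f : Mem → PMF Mem} (J : ℕ → Mem → Prop) {N : ℕ}
    (h : ∀ i m, i < N → J i m → ∀ m' ∈ (f m).support, J (i + 1) m') (k i : ℕ) (hk : i + k ≤ N)
    (m : Mem) (hm : J i m) : ∀ m' ∈ (iterRun f k m).support, J (i + k) m' := by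
  induction k generalizing i m with
  | zero =>
    intro m' hm'
    simp only [iterRun, PMF.mem_support_pure_iff] at hm'
    exact hm' ▸ hm
  | succ k ih =>
    intro m' hm'
    obtain ⟨m₁, h₁, h₂⟩ := (PMF.mem_support_bind_iff _ _ _).1 hm'
    have := ih (i + 1) (by omega) m₁ (h i m (by omega) hm m₁ h₁) m' h₂
    rwa [show i + 1 + k = i + (k + 1) by ring] at this

/-- Repeating a step that reaches the absorbing set `G` with probability `p` fails with probability at
most `(1 - p) ^ k`. -/
theorem iterRun_compl_le {f : Mem → PMF Mem} {J : Mem → Prop} {G : Set Mem} {p : ℝ≥0∞}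
    (hJ : ∀ m, J m → ∀ m' ∈ (f m).support, J m' ∧ (m ∈ G → m' ∈ G))
    (hp : ∀ m, J m → p ≤ (f m).toOuterMeasure G) (k : ℕ) (m : Mem) (hm : J m) :
    (iterRun f k m).toOuterMeasure Gᶜ ≤ (1 - p) ^ k ∧
      (m ∈ G → (iterRun f k m).toOuterMeasure Gᶜ = 0) := by
  classical
  induction k generalizing m with
  | zero =>
    simp only [iterRun, PMF.toOuterMeasure_pure_apply, pow_zero]
    split_ifs <;> simp_all
  | succ k ih =>
    have hstep : (f m).toOuterMeasure Gᶜ ≤ 1 - p := by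
      refine ENNReal.le_sub_of_add_le_right ?_ ?_
      · exact ne_top_of_le_ne_top ENNReal.one_ne_top ((hp m hm).trans
          (toOuterMeasure_add_compl (f m) G ▸ le_self_add))
      · rw [← toOuterMeasure_add_compl (f m) G, add_comm]
        exact add_le_add_left (hp m hm) _
    have hle : (iterRun f (k + 1) m).toOuterMeasure Gᶜ ≤ (f m).toOuterMeasure Gᶜ * (1 - p) ^ k := by
      rw [iterRun, PMF.toOuterMeasure_bind_apply, PMF.toOuterMeasure_apply, ← ENNReal.tsum_mul_right]
      refine ENNReal.tsum_le_tsum fun m' => ?_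
      by_cases h0 : f m m' = 0
      · simp [h0]
      have hm' := hJ m hm m' h0
      by_cases hG : m' ∈ G
      · simp [(ih m' hm'.1).2 hG]
      · rw [Set.indicator_of_mem (by exact hG)]
        exact mul_le_mul_right (ih m' hm'.1).1 _
    refine ⟨hle.trans ?_, fun hG => ?_⟩
    · rw [pow_succ']
      exact mul_le_mul_left hstep _
    · have : (f m).toOuterMeasure G = 1 :=
        (PMF.toOuterMeasure_apply_eq_one_iff (p := f m) (s := G)).2 fun m' hm' =>
          (hJ m hm m' hm').2 hG
      have h2 := toOuterMeasure_add_compl (f m) G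
      rw [this] at h2
      have : (f m).toOuterMeasure Gᶜ = 0 := by
        have h3 : (1 : ℝ≥0∞) + (f m).toOuterMeasure Gᶜ = 1 + 0 := by rw [h2, add_zero]
        exact (ENNReal.add_right_inj ENNReal.one_ne_top).1 h3
      rw [this, zero_mul] at hle
      exact le_antisymm hle bot_le

theorem one_sub_inv_pow_le (k : ℕ) : (1 - 2⁻¹ ^ k : ℝ≥0∞) ^ 2 ^ k ≤ 2⁻¹ := by
  have h1 : (1 - 2⁻¹ ^ k : ℝ≥0∞) = ENNReal.ofReal (1 - 1 / (2 ^ k : ℕ)) := by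
    rw [ENNReal.ofReal_sub _ (by positivity), ENNReal.ofReal_one, one_div,
      ENNReal.ofReal_inv_of_pos (by positivity), ENNReal.ofReal_natCast]
    simp [ENNReal.inv_pow]
  have h0 : (1 : ℝ) ≤ (2 ^ k : ℕ) := by exact_mod_cast Nat.one_le_two_pow
  rw [h1, ← ENNReal.ofReal_pow (by rw [sub_nonneg, div_le_one (by linarith)]; exact h0)]
  have h2 := Real.one_sub_div_pow_le_exp_neg (n := 2 ^ k) (t := 1) h0
  have h3 : Real.exp (-1) ≤ 2⁻¹ := by
    rw [Real.exp_neg]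
    gcongr
    linarith [Real.add_one_le_exp 1]
  calc ENNReal.ofReal ((1 - 1 / (2 ^ k : ℕ)) ^ 2 ^ k) ≤ ENNReal.ofReal 2⁻¹ :=
        ENNReal.ofReal_le_ofReal (h2.trans h3)
    _ = 2⁻¹ := by rw [ENNReal.ofReal_inv_of_pos (by norm_num)]; simp

/-! ### One stage -/

section Stage

variable {n d D : ℕ} {R : DistanceSpace (Fin n)} {m : Mem} {g : Fin n → Fin n → ℝ}

/-- The output set of the memory is a `D`-outlier set, and register `8` holds its size. -/
structure Best (R : DistanceSpace (Fin n)) (D : ℕ) (m : Mem) : Prop where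
  isOutlierSet : R.IsOutlierSet D (outSet n m)
  card : m.word 8 = #(outSet n m)

theorem Best.agree {L : List Loc} {m m' : Mem} (h : Best R D m) (hA : Agree L m m')
    (hL : Loc.word 8 ∉ L ∧ Loc.wordArr 0 ∉ L) : Best R D m' := by
  have : outSet n m' = outSet n m := by simp only [outSet, hA.wordArr 0 hL.2]
  exact ⟨this ▸ h.1, by rw [this, hA.word 8 hL.1, h.2]⟩

theorem Best.word_le (h : Best R D m) : m.word 8 ≤ n :=
  h.card.trans_le ((card_le_univ _).trans_eq (Fintype.card_fin n))

theorem tryCode_spec (hm : Ready R d m) (hB : Best R D m) (hg : Stored m g) (hR : Remainder R D g) :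
    Ready R d (tryCode.eval m) ∧ Best R D (tryCode.eval m) ∧ Stored (tryCode.eval m) g ∧
    Lists (tryCode.eval m) {x : Fin n | 0 < g x x} ∧ (tryCode.eval m).word 8 ≤ m.word 8 ∧
    ∃ C, IsCandidate g C ∧ (tryCode.eval m).word 8 ≤ #C := by
  simp only [tryCode, eval]
  have hA₁ := markCode.agree_eval m
  have hM₁ := marked_markCode hm hg
  set m₁ := markCode.eval m
  have hm₁ := hm.agree hA₁ (by decide)
  have hg₁ := hg.agree hA₁ (by decide)
  have hB₁ := hB.agree hA₁ (by decide)
  have h8₁ := hA₁.word 8 (by decide)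
  have hA₂ := matchCode.agree_eval m₁
  obtain ⟨C, hC, hM₂⟩ := marked_matchCode hm₁ hg₁ hM₁
  set m₂ := matchCode.eval m₁
  have hm₂ := hm₁.agree hA₂ (by decide)
  have hg₂ := hg₁.agree hA₂ (by decide)
  have hB₂ := hB₁.agree hA₂ (by decide)
  have h8₂ := hA₂.word 8 (by decide)
  have hA₃ := countCode.agree_eval m₂
  have hc := word_countCode hm₂ hM₂
  set m₃ := countCode.eval m₂
  have hm₃ := hm₂.agree hA₃ (by decide)
  have hg₃ := hg₂.agree hA₃ (by decide)
  have hB₃ := hB₂.agree hA₃ (by decide)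
  have hM₃ := hM₂.agree hA₃ (by decide)
  have h8₃ := hA₃.word 8 (by decide)
  have hA₄ := updateCode.agree_eval m₃
  obtain ⟨hle, hle', hor⟩ := updateCode_spec hm₃ hM₃ hc
  set m₄ := updateCode.eval m₃
  have hm₄ := hm₃.agree hA₄ (by decide)
  have hg₄ := hg₃.agree hA₄ (by decide)
  have hB₄ : Best R D m₄ := by
    rcases hor with ⟨h1, h2⟩ | ⟨h1, h2⟩
    · exact ⟨h2 ▸ hB₃.1, by rw [h1, h2, hB₃.2]⟩
    · exact ⟨h2 ▸ hR.isOutlierSet hC.1, by rw [h1, h2]⟩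
  have hA₅ := collectCode.agree_eval m₄
  have h8₅ := hA₅.word 8 (by decide)
  refine ⟨hm₄.agree hA₅ (by decide), hB₄.agree hA₅ (by decide), hg₄.agree hA₅ (by decide),
    lists_collectCode hm₄ hg₄, by omega, C, hC, by omega⟩

/-- The memory after `drawCode` has drawn `r`. -/
def drawn (m : Mem) (r : ℕ) : Mem :=
  ((m.setWord 12 1).setWord 11 (m.word 13 - 1)).setWord 15 r

theorem agree_drawn (m : Mem) (r : ℕ) : Agree [.word 11, .word 12, .word 15] m (drawn m r) := by
  constructor <;> intro y hy <;> simp_all [drawn]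

theorem run_stageCode_pos (h3 : (tryCode.eval m).word 3 = 0) (h : 0 < (tryCode.eval m).word 13) :
    stageCode.run m =
      (PMF.uniformOfFintype (Fin ((tryCode.eval m).word 13 - 1 + 1))).map
        fun r : Fin _ => pivotAtCode.eval (drawn (tryCode.eval m) r) := by
  have hr : ∀ m, pivotAtCode.run m = PMF.pure (pivotAtCode.eval m) := Code.run_eq_pure (by decide)
  rw [stageCode, run, Code.run_eq_pure (by decide), PMF.pure_bind, run]
  have ht : (Test.word Cmp.lt 3 13).holds (tryCode.eval m) := by
    simpa [Test.holds, Cmp.holds, h3] using h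
  rw [if_pos ht, drawCode]
  simp only [run]
  rw [Instr.exec, PMF.pure_bind, Instr.exec, PMF.pure_bind, Instr.exec_wordRand, PMF.bind_map, PMF.map]
  simp only [Function.comp_def, hr]
  simp only [setWord_word]
  rfl

theorem run_stageCode_neg (h3 : (tryCode.eval m).word 3 = 0) (h : (tryCode.eval m).word 13 = 0) :
    stageCode.run m = PMF.pure (tryCode.eval m) := by
  rw [stageCode, run, Code.run_eq_pure (by decide), PMF.pure_bind, run]
  simp [Test.holds, Cmp.holds, h3, h, run]

theorem stored_pivotAtCode (hm : Ready R d m) (hg : Stored m g)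
    {b : Fin n} {r : ℕ} (hr : m.wordArr 3 r = b) :
    Stored (pivotAtCode.eval (drawn m r)) (pivot g b) := by
  have hA : Agree (targets (wordLoad 14 3 15)) (drawn m r) ((wordLoad 14 3 15).eval (drawn m r)) :=
    Instr.agree_eval (wordLoad 14 3 15) _
  have hA' := agree_drawn m r
  refine stored_pivotCode ((hm.agree hA' (by decide)).agree hA (by decide))
    ((hg.agree hA' (by decide)).agree hA (by decide)) b ?_
  simp [Instr.eval, drawn, hr]

/-- The invariant of the stages: after `t` stages the kernel is what remains after splitting off `t`
coordinates. -/
def StageInv (R : DistanceSpace (Fin n)) (d D t : ℕ) (m : Mem) : Prop :=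
  Ready R d m ∧ Best R D m ∧ ∃ g, Stored m g ∧ Remainder R t g

theorem StageInv.agree {t : ℕ} {L : List Loc} {m m' : Mem} (h : StageInv R d D t m)
    (hA : Agree L m m')
    (hL : KeepsReady L ∧ (Loc.word 8 ∉ L ∧ Loc.wordArr 0 ∉ L) ∧ Loc.realArr 1 ∉ L) :
    StageInv R d D t m' := by
  obtain ⟨h1, h2, g, h3, h4⟩ := h
  exact ⟨h1.agree hA hL.1, h2.agree hA hL.2.1, g, h3.agree hA hL.2.2, h4⟩

/-- Every outcome of a stage keeps the invariant and does not worsen the best set. -/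
theorem StageInv.step {t : ℕ} (ht : t ≤ D) (h : StageInv R d D t m) :
    ∀ m' ∈ (stageCode.run m).support, StageInv R d D (t + 1) m' ∧
      m'.word 8 ≤ (tryCode.eval m).word 8 ∧ m'.word 8 ≤ m.word 8 := by
  obtain ⟨hm, hB, g, hg, hR⟩ := h
  obtain ⟨hm₁, hB₁, hg₁, hL, h8, -⟩ := tryCode_spec hm hB hg (hR.mono ht)
  intro m' hm'
  rcases Nat.eq_zero_or_pos ((tryCode.eval m).word 13) with hc | hc
  · rw [run_stageCode_neg hm₁.zero hc, PMF.mem_support_pure_iff] at hm'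
    subst hm'
    exact ⟨⟨hm₁, hB₁, g, hg₁, hR.mono (by omega)⟩, le_rfl, h8⟩
  · rw [run_stageCode_pos hm₁.zero hc] at hm'
    obtain ⟨r, -, rfl⟩ := (PMF.mem_support_map_iff _ _ _).1 hm'
    have hrc : (r : ℕ) < #{x : Fin n | 0 < g x x} := by
      have := r.2
      have := hL.1
      omega
    obtain ⟨b, hb, hb'⟩ := hL.2.1 r hrc
    have hA := (agree_drawn (tryCode.eval m) r)
    have hA' := pivotAtCode.agree_eval (drawn (tryCode.eval m) r)
    refine ⟨⟨(hm₁.agree hA (by decide)).agree hA' (by decide),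
      (hB₁.agree hA (by decide)).agree hA' (by decide), _, stored_pivotAtCode hm₁ hg₁ hb',
      hR.pivot (mem_filter.1 hb).2⟩, ?_⟩
    rw [hA'.word 8 (by decide), hA.word 8 (by decide)]
    exact ⟨le_rfl, h8⟩

/-- The stage as it is run inside its loop. -/
def stageStep (m : Mem) : PMF Mem := (stageCode.run m).map (Mem.bump 6)

theorem StageInv.stageStep {t v : ℕ} (ht : t ≤ D) (h : StageInv R d D t m) (hv : m.word 8 ≤ v) :
    ∀ m' ∈ (stageStep m).support, StageInv R d D (t + 1) m' ∧ m'.word 8 ≤ v := by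
  intro m' hm'
  obtain ⟨m₁, h₁, rfl⟩ := (PMF.mem_support_map_iff _ _ _).1 hm'
  have := h.step ht m₁ h₁
  have hA := agree_bump m₁ 6
  exact ⟨this.1.agree hA (by decide), by rw [hA.word 8 (by decide)]; exact this.2.2.trans hv⟩

theorem StageInv.stages {t v k : ℕ} (ht : t + k ≤ D + 1) (h : StageInv R d D t m)
    (hv : m.word 8 ≤ v) :
    ∀ m' ∈ (iterRun RealRAM.stageStep k m).support, StageInv R d D (t + k) m' ∧ m'.word 8 ≤ v :=
  mem_support_iterRun (fun i m => StageInv R d D i m ∧ m.word 8 ≤ v) (N := D + 1)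
    (fun _ _ hi hm => hm.1.stageStep (by omega) hm.2) k t ht m ⟨h, hv⟩

/-- A stage whose candidate is good succeeds for every outcome, since later stages only improve the best
set. -/
theorem stages_success_of_candidate {E : Type*} [NormedAddCommGroup E] [InnerProductSpace ℝ E]
    {O : Finset (Fin n)} {q t : ℕ} (ht : t + q ≤ D)
    (hm : Ready R d m) (hB : Best R D m) (hg : Stored m g) (hR : Remainder R t g)
    (hO : SpansOff E O q g) (hN : #{x | 0 < g x x} ≤ 2 * #{x ∈ O | 0 < g x x}) :
    2⁻¹ ^ q ≤ (iterRun stageStep (q + 1) m).toOuterMeasure {m | m.word 8 ≤ 2 * #O} := by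
  refine (pow_le_one₀ bot_le (by simp)).trans_eq (Eq.symm ?_)
  refine (PMF.toOuterMeasure_apply_eq_one_iff _ _).2 fun m' hm' => ?_
  obtain ⟨m₁, h₁, h₂⟩ := (PMF.mem_support_bind_iff _ _ _).1 hm'
  obtain ⟨m₂, h₃, rfl⟩ := (PMF.mem_support_map_iff _ _ _).1 h₁
  obtain ⟨hI, h8, -⟩ := StageInv.step (t := t) (by omega) ⟨hm, hB, g, hg, hR⟩ m₂ h₃
  obtain ⟨-, -, -, -, -, C, hC, hC'⟩ := tryCode_spec hm hB hg (hR.mono (by omega))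
  have hA := agree_bump m₂ 6
  refine ((hI.agree hA (by decide)).stages (v := 2 * #O) (by omega) ?_ m' h₂).2
  rw [hA.word 8 (by decide)]
  exact (h8.trans hC').trans (hC.card_le hO hN)

/-- The stages succeed with probability `2 ^ (-q)` when the kernel spans at most `q` dimensions outside
the optimal outlier set `O`: either the next candidate is good, or at least half of the points of
positive norm lie outside `O`, and pivoting on one of them lowers `q`. -/
theorem stages_success {E : Type*} [NormedAddCommGroup E] [InnerProductSpace ℝ E]
    [FiniteDimensional ℝ E] {O : Finset (Fin n)} (q t : ℕ) (ht : t + q ≤ D) (m : Mem)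
    (g : Fin n → Fin n → ℝ) (hm : Ready R d m) (hB : Best R D m) (hg : Stored m g)
    (hR : Remainder R t g) (hO : SpansOff E O q g) :
    2⁻¹ ^ q ≤ (iterRun stageStep (q + 1) m).toOuterMeasure {m | m.word 8 ≤ 2 * #O} := by
  classical
  induction q generalizing t m g with
  | zero =>
    refine stages_success_of_candidate ht hm hB hg hR hO ?_
    refine (card_le_card fun x hx => ?_).trans (Nat.le_mul_of_pos_left _ two_pos)
    simp only [mem_filter, mem_univ, true_and] at hx ⊢
    exact ⟨by_contra fun hxO => hx.ne' (hO.eq_zero_of_zero hxO), hx⟩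
  | succ q ih =>
    by_cases hN : #{x | 0 < g x x} ≤ 2 * #{x ∈ O | 0 < g x x}
    · exact stages_success_of_candidate ht hm hB hg hR hO hN
    obtain ⟨hm₁, hB₁, hg₁, hL, -, -⟩ := tryCode_spec hm hB hg (hR.mono (by omega))
    have hc : 0 < (tryCode.eval m).word 13 := by rw [hL.1]; omega
    rw [iterRun, stageStep, run_stageCode_pos hm₁.zero hc, PMF.map_comp, PMF.bind_map, pow_succ']
    refine toOuterMeasure_bind_uniform
      {r | ∃ b ∉ O, 0 < g b b ∧ (tryCode.eval m).wordArr 3 r = (b : ℕ)} ?_ _ fun r hr => ?_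
    · have h1 : #{x | 0 < g x x} = #{x ∈ O | 0 < g x x} + #{x | x ∉ O ∧ 0 < g x x} := by
        rw [← card_union_of_disjoint]
        · congr 1
          ext x
          simp only [mem_filter, mem_univ, true_and, mem_union]
          tauto
        · refine disjoint_left.2 fun x hx hx' => ?_
          exact (mem_filter.1 hx').2.1 (mem_filter.1 hx).1
      have h2 : #{x : Fin n | x ∉ O ∧ 0 < g x x} ≤
          #{r : Fin ((tryCode.eval m).word 13 - 1 + 1) |
            ∃ b ∉ O, 0 < g b b ∧ (tryCode.eval m).wordArr 3 r = (b : ℕ)} := by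
        rw [← card_map Fin.valEmbedding]
        refine (card_le_card fun y hy => ?_).trans
          (card_image_le (f := fun r : Fin _ => (tryCode.eval m).wordArr 3 (r : ℕ)))
        obtain ⟨x, hx, rfl⟩ := mem_map.1 hy
        simp only [mem_filter, mem_univ, true_and] at hx
        obtain ⟨r, hr, hr'⟩ := hL.2.2 x (by simpa using hx.2)
        rw [← hL.1] at hr
        exact mem_image.2 ⟨⟨r, by omega⟩, by simpa using ⟨x, hx.1, hx.2, hr'⟩, hr'⟩
      have h3 := hL.1
      omega
    · obtain ⟨b, hbO, hb, hb'⟩ := (mem_filter.1 hr).2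
      have hA := agree_drawn (tryCode.eval m) r
      have hA' := pivotAtCode.agree_eval (drawn (tryCode.eval m) r)
      have hA'' := agree_bump (pivotAtCode.eval (drawn (tryCode.eval m) r)) 6
      exact ih (t + 1) (by omega) _ (pivot g b)
        (((hm₁.agree hA (by decide)).agree hA' (by decide)).agree hA'' (by decide))
        (((hB₁.agree hA (by decide)).agree hA' (by decide)).agree hA'' (by decide))
        ((stored_pivotAtCode hm₁ hg₁ hb').agree hA'' (by decide)) (hR.pivot hb)
        (hO.pivot hbO hb.ne')

/-! ### One repetition -/

/-- The memory after `drawBaseCode` has drawn `r`. -/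
def drawnBase (m : Mem) (r : ℕ) : Mem :=
  ((m.setWord 12 1).setWord 11 (m.word 0 - 1)).setWord 14 r

theorem agree_drawnBase (m : Mem) (r : ℕ) :
    Agree [.word 11, .word 12, .word 14] m (drawnBase m r) := by
  constructor <;> intro y hy <;> simp_all [drawnBase]

/-- The memory at the start of the stages. -/
def stagesStart (m : Mem) (r : ℕ) : Mem := (gramCode.eval (drawnBase m r)).setWord 6 0

theorem agree_stagesStart (m : Mem) (r : ℕ) :
    Agree (targets (.seq drawBaseCode (.seq gramCode (wordConst 6 0)))) m (stagesStart m r) :=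
  (((agree_drawnBase m r).mono (by decide)).trans ((gramCode.agree_eval _).mono (by decide))).trans
    ((agree_setWord _ 6 0).mono (by decide))

theorem run_repCode (hm : Ready R d m) : repCode.run m =
    (PMF.uniformOfFintype (Fin (m.word 0 - 1 + 1))).bind
      fun r : Fin _ => iterRun stageStep (d + 1) (stagesStart m r) := by
  have hr : ∀ m, gramCode.run m = PMF.pure (gramCode.eval m) := Code.run_eq_pure (by decide)
  rw [repCode, drawBaseCode]
  simp only [run]
  rw [Instr.exec, PMF.pure_bind, Instr.exec, PMF.pure_bind, Instr.exec_wordRand, PMF.bind_map]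
  simp only [Function.comp_def, hr, PMF.pure_bind]
  simp only [setWord_word]
  refine congrArg _ (funext fun r => ?_)
  have hA := agree_drawnBase m r
  have hA' := gramCode.agree_eval (drawnBase m r)
  have h7 := ((hm.agree hA (by decide)).agree hA' (by decide)).stages
  change iterRun stageStep ((gramCode.eval (drawnBase m r)).word 7) _ = _
  rw [h7]
  rfl

theorem stageInv_stagesStart (hm : Ready R d m) (hB : Best R D m)
    (r : Fin (m.word 0 - 1 + 1)) : StageInv R d D 0 (stagesStart m r) := by
  have hA := agree_stagesStart m r
  refine ⟨hm.agree hA (by decide), hB.agree hA (by decide), ?_⟩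
  rcases Nat.eq_zero_or_pos n with rfl | hn
  · exact ⟨fun _ _ => 0, fun i => i.elim0, fun i => i.elim0, fun _ _ => 0, fun i => i.elim0⟩
  · have hr : (r : ℕ) < n := by have := hm.size; omega
    exact ⟨_, (stored_gramCode (hm.agree (agree_drawnBase m r) (by decide)) ⟨r, hr⟩
      (by simp [drawnBase])).agree (agree_setWord _ 6 0) (by decide), remainder_gram R _⟩

/-- Every outcome of a repetition leaves a valid output that is no worse than before. -/
theorem repCode_safe (hd : d ≤ D) (hm : Ready R d m) (hB : Best R D m) :
    ∀ m' ∈ (repCode.run m).support, Ready R d m' ∧ Best R D m' ∧ m'.word 8 ≤ m.word 8 := by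
  intro m' hm'
  rw [run_repCode hm] at hm'
  obtain ⟨r, -, hr⟩ := (PMF.mem_support_bind_iff _ _ _).1 hm'
  have h8 := (agree_stagesStart m r).word 8 (by decide)
  have := (stageInv_stagesStart hm hB r).stages (k := d + 1) (by omega) h8.le m' hr
  exact ⟨this.1.1, this.1.2.1, this.2⟩

/-- A repetition succeeds with probability `2 ^ (-(d + 1))`: unless half of all points are outliers, the
base point lies outside an optimal outlier set with probability at least `1 / 2`. -/
theorem repCode_success (hd : d = min D n) (hm : Ready R d m) (hB : Best R D m) :
    2⁻¹ ^ (d + 1) ≤ (repCode.run m).toOuterMeasure {m | m.word 8 ≤ 2 * R.opt D} := by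
  obtain ⟨O, hO, hOcard⟩ := R.exists_isOutlierSet_card_eq_opt D
  rw [← hOcard]
  by_cases hn : n ≤ 2 * #O
  · refine (pow_le_one₀ bot_le (by simp)).trans_eq (Eq.symm ?_)
    refine (PMF.toOuterMeasure_apply_eq_one_iff _ _).2 fun m' hm' => ?_
    exact ((repCode_safe (by omega) hm hB m' hm').2.2.trans hB.word_le).trans hn
  · have hsize := hm.size
    rw [run_repCode hm, pow_succ']
    refine toOuterMeasure_bind_uniform {r | ∃ b ∉ O, (b : ℕ) = r} ?_ _ fun r hr => ?_
    · have h1 : #Oᶜ ≤ #{r : Fin (m.word 0 - 1 + 1) | ∃ b ∉ O, (b : ℕ) = r} := by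
        rw [← card_map Fin.valEmbedding, ← card_map (s := filter _ _) Fin.valEmbedding]
        refine card_le_card fun y hy => ?_
        obtain ⟨x, hx, rfl⟩ := mem_map.1 hy
        exact mem_map.2 ⟨⟨x, by omega⟩, by simpa using ⟨x, mem_compl.1 hx, rfl⟩, rfl⟩
      rw [card_compl, Fintype.card_fin] at h1
      omega
    · obtain ⟨b, hbO, hb⟩ := (mem_filter.1 hr).2
      have hA := agree_stagesStart m r
      refine stages_success d 0 (by omega) _ (gram R b) (hm.agree hA (by decide))
        (hB.agree hA (by decide)) ?_ (remainder_gram R b)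
        (by simpa [hd] using spansOff_gram hO hbO)
      exact (stored_gramCode (hm.agree (agree_drawnBase m r) (by decide)) b
        (by simp [drawnBase, hb])).agree (agree_setWord _ 6 0) (by decide)

end Stage

/-! ### The setup -/

section Setup

variable {n : ℕ} (R : DistanceSpace (Fin n)) (D : ℕ)

/-- The memory once the dimension has been lowered to the number of points. -/
def clamped : Mem := clampCode.eval (inputMem R D)

theorem clamped_word_one : (clamped R D).word 1 = min D n := by
  by_cases h : n < D
  · simp [clamped, clampCode, eval, Instr.eval, Test.holds, Cmp.holds, inputMem, h, h.le]
  · simp [clamped, clampCode, eval, Test.holds, Cmp.holds, inputMem, h, not_lt.1 h]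

theorem agree_clamped : Agree [.word 1] (inputMem R D) (clamped R D) :=
  (clampCode.agree_eval _).mono (by decide)

theorem clamped_word_zero : (clamped R D).word 0 = n :=
  ((agree_clamped R D).word 0 (by decide)).trans rfl

theorem inputMem_realArr (i j : Fin n) : (inputMem R D).realArr 0 (i * n + j) = R.dist i j := by
  have h : (i * n + j : ℕ) < n * n := cell_lt i.2 j.2
  have h1 : Fin.divNat (⟨i * n + j, h⟩ : Fin (n * n)) = i := by
    refine Fin.ext ?_
    change (i * n + j : ℕ) / n = i
    rw [mul_comm, Nat.mul_add_div (by have := i.2; omega), Nat.div_eq_of_lt j.2,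
      add_zero]
  have h2 : Fin.modNat (⟨i * n + j, h⟩ : Fin (n * n)) = j := by
    refine Fin.ext ?_
    change (i * n + j : ℕ) % n = j
    rw [mul_comm, Nat.mul_add_mod, Nat.mod_eq_of_lt j.2]
  simp [inputMem, h, h1, h2]

theorem setup_spec : Ready R (min D n) (setup.eval (clamped R D)) ∧
    Best R D (setup.eval (clamped R D)) := by
  have hA := agree_clamped R D
  have hn := clamped_word_zero R D
  have hd := clamped_word_one R D
  have h3 : (clamped R D).word 3 = 0 := (hA.word 3 (by decide)).trans rfl
  have hr0 : (clamped R D).real 0 = 0 := (hA.real 0 (by decide)).trans rfl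
  have hin : ∀ i j : Fin n, (clamped R D).realArr 0 (i * n + j) = R.dist i j := fun i j => by
    rw [hA.realArr 0 (by decide)]; exact inputMem_realArr R D i j
  generalize clamped R D = m at *
  -- the number of repetitions
  set m₁ := (loop 9 1 (wordAdd 5 5 5)).eval ((wordConst 5 2).eval m) with hm₁
  have hA₁ : Agree [.word 5, .word 9, .word 2] m m₁ :=
    ((Instr.agree_eval (wordConst 5 2) m).mono (by decide)).trans
      ((Code.agree_eval (loop 9 1 (wordAdd 5 5 5)) _).mono (by decide))
  have h5 : m₁.word 5 = 2 ^ (min D n + 1) := by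
    have := eval_loop_induction (x := 9) (y := 1) (p := wordAdd 5 5 5)
      (m := (wordConst 5 2).eval m) (fun k m' => m'.word 5 = 2 ^ (k + 1)) (by decide)
      (by simp [Instr.eval]) (fun k m' _ _ _ h => by simp [eval, Instr.eval, h]; ring)
    rwa [show ((wordConst 5 2).eval m).word 1 = min D n by simp [Instr.eval, hd]] at this
  -- the other registers
  set m₂ := (wordConst 11 0).eval ((wordAdd 8 0 3).eval ((realConst 1 2).eval
    ((wordAdd 7 1 2).eval ((wordConst 2 1).eval m₁)))) with hm₂
  have hA₂ : Agree [.word 2, .word 7, .real 1, .word 8, .word 11] m₁ m₂ := by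
    constructor <;> intro y hy <;> simp_all [Instr.eval]
  have h7 : m₂.word 7 = min D n + 1 := by
    simp [hm₂, Instr.eval, hA₁.word 1 (by decide), hd]
  have h8 : m₂.word 8 = n := by
    simp [hm₂, Instr.eval, hA₁.word 0 (by decide), hA₁.word 3 (by decide), hn, h3]
  have h11 : m₂.word 11 = 0 := by simp [hm₂, Instr.eval]
  have hr1 : m₂.real 1 = 2 := by simp [hm₂, Instr.eval]
  have hn₂ : m₂.word 0 = n := by rw [hA₂.word 0 (by decide), hA₁.word 0 (by decide), hn]
  -- the tables
  set P : Code := loop 9 0 (wordStore 1 9 11 ;; wordAdd 11 11 0 ;; wordConst 12 1 ;; wordStore 0 9 12)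
    with hP
  have he : setup.eval m = P.eval m₂ := rfl
  have hA₃ := P.agree_eval m₂
  have hT : (∀ i < n, (P.eval m₂).wordArr 1 i = i * n) ∧
      ∀ i < n, (P.eval m₂).wordArr 0 i = 1 := by
    have := eval_loop_induction (x := 9) (y := 0)
      (p := wordStore 1 9 11 ;; wordAdd 11 11 0 ;; wordConst 12 1 ;; wordStore 0 9 12) (m := m₂)
      (fun k m' => m'.word 11 = k * n ∧ (∀ i < k, m'.wordArr 1 i = i * n) ∧
        ∀ i < k, m'.wordArr 0 i = 1) (by decide) (by simp [h11]) ?_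
    · rw [hn₂] at this
      exact this.2
    rintro k m' hk h9 hA ⟨h1, h2, h3⟩
    have hn' : m'.word 0 = n := (hA.word 0 (by decide)).trans hn₂
    refine ⟨by simp [eval, Instr.eval, h1, hn']; ring, fun i hi => ?_, fun i hi => ?_⟩ <;>
    · by_cases hik : i = k
      · simp [eval, Instr.eval, h9, hik, h1]
      · have hlt : i < k := by omega
        simp [eval, Instr.eval, h9, hik, h2 i hlt, h3 i hlt]
  rw [he]
  have hout : outSet n (P.eval m₂) = univ := by
    ext i
    simp [outSet, hT.2 i i.2]
  refine ⟨⟨?_, ?_, ?_, ?_, ?_, ?_, hT.1, ?_⟩, ?_, ?_⟩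
  · rw [hA₃.word 0 (by decide), hn₂]
  · rw [hA₃.word 3 (by decide), hA₂.word 3 (by decide), hA₁.word 3 (by decide), h3]
  · rw [hA₃.word 5 (by decide), hA₂.word 5 (by decide), h5]
  · rw [hA₃.word 7 (by decide), h7]
  · rw [hA₃.real 0 (by decide), hA₂.real 0 (by decide), hA₁.real 0 (by decide), hr0]
  · rw [hA₃.real 1 (by decide), hr1]
  · rw [hA₃.realArr 0 (by decide), hA₂.realArr 0 (by decide), hA₁.realArr 0 (by decide)]
    exact hin
  · rw [hout]; exact R.isOutlierSet_univ D
  · rw [hout, hA₃.word 8 (by decide), h8]; simp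

/-- The repetition as it is run inside its loop. -/
def repStep (m : Mem) : PMF Mem := (repCode.run m).map (Mem.bump 4)

/-- The memory at the start of the repetitions. -/
def repsStart : Mem := (setup.eval (clamped R D)).setWord 4 0

theorem run_mainCode : mainCode.run (inputMem R D) =
    iterRun repStep (2 ^ (min D n + 1)) (repsStart R D) := by
  rw [mainCode, run, Code.run_eq_pure (by decide), PMF.pure_bind, run, Code.run_eq_pure (by decide),
    PMF.pure_bind]
  change iterRun repStep ((setup.eval (clamped R D)).word 5) _ = _
  rw [(setup_spec R D).1.reps]
  rfl

theorem mainCode_inv_step (m : Mem) (hm : Ready R (min D n) m ∧ Best R D m) :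
    ∀ m' ∈ (repStep m).support, (Ready R (min D n) m' ∧ Best R D m') ∧
      (m.word 8 ≤ 2 * R.opt D → m'.word 8 ≤ 2 * R.opt D) := by
  intro m' hm'
  obtain ⟨m₁, h₁, rfl⟩ := (PMF.mem_support_map_iff _ _ _).1 hm'
  obtain ⟨h2, h3, h4⟩ := repCode_safe (min_le_left D n) hm.1 hm.2 m₁ h₁
  have hA := agree_bump m₁ 4
  exact ⟨⟨h2.agree hA (by decide), h3.agree hA (by decide)⟩, fun h => by
    rw [hA.word 8 (by decide)]; exact h4.trans h⟩

theorem repsStart_inv : Ready R (min D n) (repsStart R D) ∧ Best R D (repsStart R D) := by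
  have hA := agree_setWord (setup.eval (clamped R D)) 4 0
  exact ⟨(setup_spec R D).1.agree hA (by decide), (setup_spec R D).2.agree hA (by decide)⟩

theorem mainCode_safe : ∀ m ∈ (mainCode.run (inputMem R D)).support, Best R D m := by
  intro m hm
  rw [run_mainCode] at hm
  exact (mem_support_iterRun (fun _ m => Ready R (min D n) m ∧ Best R D m)
    (N := 2 ^ (min D n + 1)) (fun _ m _ h m' hm' => (mainCode_inv_step R D m h m' hm').1)
    _ 0 (by omega) _ (repsStart_inv R D) m hm).2

theorem mainCode_success :
    2⁻¹ ≤ (mainCode.run (inputMem R D)).toOuterMeasure {m | m.word 8 ≤ 2 * R.opt D} := by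
  rw [run_mainCode]
  have h := (iterRun_compl_le (f := repStep) (J := fun m => Ready R (min D n) m ∧ Best R D m)
    (G := {m | m.word 8 ≤ 2 * R.opt D}) (p := 2⁻¹ ^ (min D n + 1)) (mainCode_inv_step R D)
    (fun m hm => ?_) (2 ^ (min D n + 1)) _ (repsStart_inv R D)).1
  · have h1 := toOuterMeasure_add_compl
      (iterRun repStep (2 ^ (min D n + 1)) (repsStart R D)) {m | m.word 8 ≤ 2 * R.opt D}
    have h2 := h.trans (one_sub_inv_pow_le _)
    rw [← ENNReal.one_sub_inv_two, tsub_le_iff_right, ← h1]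
    exact add_le_add_right h2 _
  · rw [repStep, PMF.toOuterMeasure_map_apply]
    refine (repCode_success rfl hm.1 hm.2).trans_eq (congrArg _ ?_)
    ext m'
    simp

/-! ### The running time -/

theorem steps_halted (s : ℕ) (m : Mem) : steps s ⟨[], m⟩ = PMF.pure ⟨[], m⟩ := by
  induction s with
  | zero => rfl
  | succ s ih => simp [steps, step, ih]

theorem Runs.le_run {P : Program} {m : Mem} {T T' : ℕ} {μ : PMF Mem} (h : Runs P m T μ) (hT : T ≤ T')
    (S : Set Mem) : μ.toOuterMeasure S ≤ (P.run m T').toOuterMeasure (haltedIn S) := by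
  have := h.mono hT [] 0 S
  simp only [steps_halted] at this
  refine le_trans (le_of_eq ?_) this
  change _ = (μ.map fun m' => (⟨[], m'⟩ : Config)).toOuterMeasure (haltedIn S)
  rw [PMF.toOuterMeasure_map_apply]
  congr 1
  ext m'
  simp [haltedIn, Config.Halted]

/-- The bounds of the loops. -/
def loopBound (n d x : ℕ) : ℕ :=
  if x = 0 then n else if x = 1 then d else if x = 7 then d + 1 else 2 ^ (d + 1)

theorem runs_mainCode : Runs mainCode.compile (inputMem R D)
    ((clampCode.size + setup.size + 2 * repCode.size + 20) * 2 ^ D * (n + 1) ^ 3)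
    (mainCode.run (inputMem R D)) := by
  set N := loopBound n (min D n) with hN
  have h1 : Runs clampCode.compile (inputMem R D) (clampCode.cost N) (clampCode.run (inputMem R D)) :=
    Code.runs_compile clampCode (by decide) (List.Subset.refl _) (by decide) _
      (by simp [clampCode, Code.limits])
  have h2 : Runs setup.compile (clamped R D) (setup.cost N) (setup.run (clamped R D)) := by
    refine Code.runs_compile setup (by decide) (List.Subset.refl _) (by decide) _ ?_
    have : setup.limits = [1, 0] := rfl
    simp [this, hN, loopBound, clamped_word_one, clamped_word_zero]
  have h3 : Runs (loop 4 5 repCode).compile (setup.eval (clamped R D)) ((loop 4 5 repCode).cost N)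
      ((loop 4 5 repCode).run (setup.eval (clamped R D))) := by
    refine Code.runs_compile (loop 4 5 repCode) (by decide) (List.Subset.refl _) (by decide) _ ?_
    have hR := (setup_spec R D).1
    have : ∀ y ∈ (loop 4 5 repCode).limits, y = 0 ∨ y = 5 ∨ y = 7 := by decide
    intro y hy
    rcases this y hy with rfl | rfl | rfl
    · simp [hN, loopBound, hR.size]
    · simp [hN, loopBound, hR.reps]
    · simp [hN, loopBound, hR.stages]
  have hmain : Runs mainCode.compile (inputMem R D)
      (1 + clampCode.cost N + (1 + setup.cost N + (loop 4 5 repCode).cost N))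
      (mainCode.run (inputMem R D)) := by
    refine h1.seq fun m' hm' => ?_
    rw [Code.run_eq_pure (by decide), PMF.mem_support_pure_iff] at hm'
    subst hm'
    refine h2.seq fun m' hm' => ?_
    rw [Code.run_eq_pure (by decide), PMF.mem_support_pure_iff] at hm'
    subst hm'
    exact h3
  refine hmain.mono ?_
  have hN0 : N 0 ≤ n + 1 := by simp [hN, loopBound]
  have hN1 : N 1 ≤ n + 1 := by simp [hN, loopBound]
  have hN7 : N 7 ≤ n + 1 := by simp [hN, loopBound]
  have c1 := clampCode.cost_le (N := N) (B := n + 1) (by omega) (by simp [clampCode, Code.limits])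
  have c2 := setup.cost_le (N := N) (B := n + 1) (by omega) (by
    have : setup.limits = [1, 0] := rfl
    simp [this, hN0, hN1])
  have c3 := repCode.cost_le (N := N) (B := n + 1) (by omega) (by
    have : ∀ y ∈ repCode.limits, y = 0 ∨ y = 7 := by decide
    intro y hy
    rcases this y hy with rfl | rfl
    exacts [hN0, hN7])
  have hB : ∀ k ≤ 3, (n + 1) ^ k ≤ (n + 1) ^ 3 := fun k hk => Nat.pow_le_pow_right (by omega) hk
  replace c1 := c1.trans (Nat.mul_le_mul_left _ (hB _ (by decide)))
  replace c2 := c2.trans (Nat.mul_le_mul_left _ (hB _ (by decide)))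
  replace c3 := c3.trans (Nat.mul_le_mul_left _ (hB _ (by decide)))
  have hB1 : 1 ≤ (n + 1) ^ 3 := Nat.one_le_pow _ _ (by omega)
  have hE : 2 ^ (min D n + 1) ≤ 2 * 2 ^ D := by
    rw [← pow_succ']
    exact Nat.pow_le_pow_right two_pos (by omega)
  have hE1 : 1 ≤ 2 ^ D := Nat.one_le_two_pow
  have hN5 : N 5 = 2 ^ (min D n + 1) := by simp [hN, loopBound]
  simp only [Code.cost, hN5]
  generalize (n + 1) ^ 3 = B at *
  generalize 2 ^ D = E at *
  generalize clampCode.cost N = a at *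
  generalize setup.cost N = b at *
  generalize repCode.cost N = r at *
  calc 1 + a + (1 + b + (3 + 2 ^ (min D n + 1) * (r + 5)))
      ≤ 1 * (E * B) + clampCode.size * (E * B) + (1 * (E * B) + setup.size * (E * B)
        + (3 * (E * B) + 2 * E * (repCode.size * B + 5 * B))) := by
        have hEB : 1 ≤ E * B := Nat.mul_pos hE1 hB1
        have hBE : B ≤ E * B := Nat.le_mul_of_pos_left _ hE1
        have := c1.trans (Nat.mul_le_mul_left clampCode.size hBE)
        have := c2.trans (Nat.mul_le_mul_left setup.size hBE)
        gcongr <;> omega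
    _ = (clampCode.size + setup.size + 2 * repCode.size + 15) * E * B := by ring
    _ ≤ _ := by gcongr; omega

end Setup

end RealRAM

end

/-- Minimizing the number of outliers of an `n`-point distance space for embedding into Euclidean
`d`-space can be randomly `2`-approximated on a real RAM in `2 ^ d * n ^ O(1)` time: there is one
program which on every input halts within the time bound and outputs a `d`-outlier set for all
outcomes of its random choices, and whose output is at most twice the optimum with probability at
least `1 / 2`. -/
theorem theorem6p1 :
    ∃ (P : RealRAM.Program) (C c : ℕ),
      ∀ (n d : ℕ), 1 ≤ d → ∀ R : DistanceSpace (Fin n),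
        (∀ σ ∈ (P.run (RealRAM.inputMem R d) (C * 2 ^ d * (n + 1) ^ c)).support,
          σ.Halted ∧ R.IsOutlierSet d (σ.output n)) ∧
        1 / 2 ≤ (P.run (RealRAM.inputMem R d) (C * 2 ^ d * (n + 1) ^ c)).toOuterMeasure
          {σ | (σ.output n).card ≤ 2 * R.opt d} := by
  refine ⟨RealRAM.mainCode.compile, RealRAM.clampCode.size + RealRAM.setup.size +
    2 * RealRAM.repCode.size + 20, 3, fun n d _ R => ?_⟩
  have hrun := (RealRAM.runs_mainCode R d).le_run le_rfl
  constructor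
  -- an event of probability one holds for every outcome
  · have h0 : (RealRAM.mainCode.run (RealRAM.inputMem R d)).toOuterMeasure
        {m | RealRAM.Best R d m} = 1 :=
      (PMF.toOuterMeasure_apply_eq_one_iff _ _).2 (RealRAM.mainCode_safe R d)
    have h1 := hrun {m | RealRAM.Best R d m}
    rw [h0] at h1
    have h2 := le_antisymm ((PMF.toOuterMeasure_mono _ fun _ _ => Set.mem_univ _).trans_eq
      ((PMF.toOuterMeasure_apply_eq_one_iff _ Set.univ).2 (Set.subset_univ _))) h1
    intro σ hσ
    obtain ⟨h3, h4⟩ := (PMF.toOuterMeasure_apply_eq_one_iff _ _).1 h2 hσ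
    exact ⟨h3, h4.isOutlierSet⟩
  · rw [one_div]
    refine (RealRAM.mainCode_success R d).trans
      ((PMF.toOuterMeasure_mono (t := {m | (RealRAM.outSet n m).card ≤ 2 * R.opt d}) _ ?_).trans
        ((hrun _).trans (PMF.toOuterMeasure_mono _ ?_)))
    · rintro m ⟨h1, h2⟩
      exact (RealRAM.mainCode_safe R d m h2).card.symm.trans_le h1
    · rintro σ ⟨⟨-, h⟩, -⟩
      exact h
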